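/- **Setting.** Let $L\ge 1$, let $\sigma:\mathbb R\to\mathbb R$ be Lipschitz, with derivative $\dot\sigma$ (defined Lebesgue-almost everywhere), and let $\beta>0$. For widths $n_0,\dots,n_L$, the fully connected network of depth $L$ has parameters $\theta=(W^{(\ell)},b^{(\ell)})_{0\le\ell<L}$ with $W^{(\ell)}\in\mathbb R^{n_\ell\times n_{\ell+1}}$, $b^{(\ell)}\in\mathbb R^{n_{\ell+1}}$, and its network function is $f_\theta(x)=\tilde\alpha^{(L)}(x;\theta)\in\mathbb R^{n_L}$, where $\alpha^{(0)}(x;\theta)=x\in\mathbb R^{n_0}$ and $$\tilde\alpha^{(\ell+1)}_k(x;\theta)=\tfrac1{\sqrt{n_\ell}}\sum_{i=1}^{n_\ell}W^{(\ell)}_{ik}\,\alpha^{(\ell)}_i(x;\theta)+\beta\, b^{(\ell)}_k,\qquad \alpha^{(\ell)}(x;\theta)=\sigma\big(\tilde\alpha^{(\ell)}(x;\theta)\big)\ \ (1\le \ell<L),$$ with $\sigma$ applied entrywise. The parameters are iid $\mathcal N(0,1)$. The neural tangent kernel (NTK) is the random matrix-valued kernel $$\Theta^{(L)}_{kk'}(x,x')=\sum_p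 \partial_{\theta_p}f_{\theta,k}(x)\,\partial_{\theta_p}f_{\theta,k'}(x'),\qquad 1\le k,k'\le n_L,\quad x,x'\in\mathbb R^{n_0},$$ the sum running over all the parameters $\theta_p$. Define recursively, for $\ell\ge1$, $$\Sigma^{(1)}(x,x')=\tfrac1{n_0}x^Tx'+\beta^2,\qquad \Sigma^{(\ell+1)}(x,x')=\mathbb E_{f\sim\mathcal N(0,\Sigma^{(\ell)})}[\sigma(f(x))\sigma(f(x'))]+\beta^2,$$ $$\dot\Sigma^{(\ell+1)}(x,x')=\mathbb E_{f\sim\mathcal N(0,\Sigma^{(\ell)})}[\dot\sigma(f(x))\dot\sigma(f(x'))],$$ $$\Theta^{(1)}_\infty=\Sigma^{(1)},\qquad \Theta^{(\ell+1)}_\infty(x,x')=\Theta^{(\ell)}_\infty(x,x')\,\dot\Sigma^{(\ell+1)}(x,x')+\Sigma^{(\ell+1)}(x,x'),$$ where $f\sim\mathcal N(0,\Sigma^{(\ell)})$ is a centered Gaussian process of covariance $\Sigma^{(\ell)}$ (only the law of the Gaussian vector $(f(x),f(x'))$ is used). **Theorem.** For all widths, every $x$ and every $k$, the map $\theta\mapsto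 f_{\theta,k}(x)$ is almost surely differentiable at the random parameter $\theta$, so that $\Theta^{(L)}$ is almost surely well defined. With $n_0$ and $n_L$ fixed, as the hidden widths $n_1,\dots,n_{L-1}\to\infty$ sequentially (first $n_1\to\infty$, then $n_2\to\infty$, and so on), the NTK converges in probability to a deterministic kernel: $$\Theta^{(L)}\to\Theta^{(L)}_\infty\otimes \mathrm{Id}_{n_L}.$$ That is, for all $x,x'\in\mathbb R^{n_0}$, all $k,k'$ and all $\varepsilon>0$, $$\limsup_{n_{L-1}\to\infty}\cdots\limsup_{n_1\to\infty}\ \mathbb P\Big(\big|\Theta^{(L)}_{kk'}(x,x')-\Theta^{(L)}_\infty(x,x')\,\delta_{kk'}\big|\ge\varepsilon\Big)=0 ,$$ and likewise, for every finite dataset $x_1,\dots,x_N\in\mathbb R^{n_0}$, with $|\cdot|$ replaced by the operator norm of $K=\Theta^{(L)}-\Theta^{(L)}_\infty\otimes\mathrm{Id}_{n_L}$ on the dataset, $$\|K\|_{op}=\sup\Big\{\big|\tfrac1{N^2}\sum_{i,j}f(x_i)^TK(x_i,x_j)f(x_j)\big|^{1/2}\ :\ f:\mathbb R^{n_0}\to\mathbb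 R^{n_L},\ \tfrac1N\sum_i\|f(x_i)\|^2\le1\Big\}.$$ -/

import Mathlib

open MeasureTheory ProbabilityTheory Filter Topology

namespace NTK

/-- Index set of the parameters of a fully connected network with input width `n₀`, hidden widths
`hs` and output width `m`, as `ParamIdx n₀ hs m`.

The hidden widths are listed **from the last hidden layer down to the first one**: a network with
hidden widths `n₁, …, n_H` corresponds to the list `[n_H, …, n₁]` and has depth `L = H + 1`.

A network without hidden layer has one connection matrix (`inW`) and one bias vector (`inB`). A
network with hidden widths `w :: ws` has the parameters of the smaller network `n₀ → ws → w`
computing the preactivations of its last hidden layer (`prev`), together with a last connection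
matrix (`lastW`) and a last bias vector (`lastB`). -/
inductive ParamIdx (n₀ : ℕ) : List ℕ → ℕ → Type
  | inW {m : ℕ} (i : Fin n₀) (k : Fin m) : ParamIdx n₀ [] m
  | inB {m : ℕ} (k : Fin m) : ParamIdx n₀ [] m
  | prev {w : ℕ} {ws : List ℕ} {m : ℕ} (p : ParamIdx n₀ ws w) : ParamIdx n₀ (w :: ws) m
  | lastW {w : ℕ} {ws : List ℕ} {m : ℕ} (i : Fin w) (k : Fin m) : ParamIdx n₀ (w :: ws) m
  | lastB {w : ℕ} {ws : List ℕ} {m : ℕ} (k : Fin m) : ParamIdx n₀ (w :: ws) m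

/-- Parameters of a network without hidden layer. -/
def ParamIdx.nilEquiv (n₀ m : ℕ) : (Fin n₀ × Fin m) ⊕ Fin m ≃ ParamIdx n₀ [] m where
  toFun
    | Sum.inl (i, k) => .inW i k
    | Sum.inr k => .inB k
  invFun
    | .inW i k => Sum.inl (i, k)
    | .inB k => Sum.inr k
  left_inv := by rintro (⟨i, k⟩ | k) <;> rfl
  right_inv := by rintro (⟨i, k⟩ | k) <;> rfl

/-- Parameters of a network with at least one hidden layer. -/
def ParamIdx.consEquiv (n₀ w : ℕ) (ws : List ℕ) (m : ℕ) :
    ParamIdx n₀ ws w ⊕ ((Fin w × Fin m) ⊕ Fin m) ≃ ParamIdx n₀ (w :: ws) m where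
  toFun
    | Sum.inl p => .prev p
    | Sum.inr (Sum.inl (i, k)) => .lastW i k
    | Sum.inr (Sum.inr k) => .lastB k
  invFun
    | .prev p => Sum.inl p
    | .lastW i k => Sum.inr (Sum.inl (i, k))
    | .lastB k => Sum.inr (Sum.inr k)
  left_inv := by rintro (p | ⟨i, k⟩ | k) <;> rfl
  right_inv := by intro p; cases p <;> rfl

instance ParamIdx.instFintype (n₀ : ℕ) : (hs : List ℕ) → (m : ℕ) → Fintype (ParamIdx n₀ hs m)
  | [], m => Fintype.ofEquiv _ (ParamIdx.nilEquiv n₀ m)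
  | w :: ws, m =>
    haveI := ParamIdx.instFintype n₀ ws w
    Fintype.ofEquiv _ (ParamIdx.consEquiv n₀ w ws m)

noncomputable instance ParamIdx.instDecidableEq (n₀ : ℕ) (hs : List ℕ) (m : ℕ) :
    DecidableEq (ParamIdx n₀ hs m) :=
  Classical.decEq _

noncomputable section

/-- One layer in the scaled parametrization: `(1/√n) Wᵀ a + β b`, with `W i k` the connection from
neuron `i` to neuron `k`. -/
def layer {n m : ℕ} (β : ℝ) (W : Fin n → Fin m → ℝ) (b : Fin m → ℝ) (a : Fin n → ℝ) :
    Fin m → ℝ :=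
  fun k => 1 / √(n : ℝ) * ∑ i, W i k * a i + β * b k

/-- The network function `f_θ(x)`, that is, the preactivations of the output layer. The
nonlinearity `σ` is applied entrywise to the preactivations of every hidden layer. -/
def network (σ : ℝ → ℝ) (β : ℝ) {n₀ : ℕ} : (hs : List ℕ) → {m : ℕ} →
    (ParamIdx n₀ hs m → ℝ) → (Fin n₀ → ℝ) → Fin m → ℝ
  | [], _, θ, x => layer β (fun i k => θ (.inW i k)) (fun k => θ (.inB k)) x
  | _ :: ws, _, θ, x =>
    layer β (fun i k => θ (.lastW i k)) (fun k => θ (.lastB k))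
      (fun i => σ (network σ β ws (fun p => θ (.prev p)) x i))

/-- The law of the parameters at initialization: iid standard Gaussians. -/
def initLaw (n₀ : ℕ) (hs : List ℕ) (m : ℕ) : Measure (ParamIdx n₀ hs m → ℝ) :=
  Measure.pi fun _ => gaussianReal 0 1

/-- The partial derivative `∂_{θ_p} f_{θ,k}(x)` of the network function. -/
def partialNetwork (σ : ℝ → ℝ) (β : ℝ) {n₀ m : ℕ} (hs : List ℕ) (p : ParamIdx n₀ hs m)
    (θ : ParamIdx n₀ hs m → ℝ) (x : Fin n₀ → ℝ) (k : Fin m) : ℝ :=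
  lineDeriv ℝ (fun θ' => network σ β hs θ' x k) θ (Pi.single p 1)

/-- Multi-dimensional kernels (matrix valued) on `ℝ^{n₀}`. -/
abbrev MatKernel (n₀ m : ℕ) : Type := (Fin n₀ → ℝ) → (Fin n₀ → ℝ) → Matrix (Fin m) (Fin m) ℝ

/-- The neural tangent kernel `Θ(θ) = ∑_p ∂_{θ_p} F(θ) ⊗ ∂_{θ_p} F(θ)`. -/
def ntk (σ : ℝ → ℝ) (β : ℝ) {n₀ m : ℕ} (hs : List ℕ) (θ : ParamIdx n₀ hs m → ℝ) : MatKernel n₀ m :=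
  fun x x' => Matrix.of fun k k' =>
    ∑ p, partialNetwork σ β hs p θ x k * partialNetwork σ β hs p θ x' k'

/-- `E[φ(f(x)) φ(f(x'))]` for a centered Gaussian process `f` of covariance `S`: the expectation is
taken with respect to the law of the pair `(f(x), f(x'))`, the centered Gaussian law on `ℝ²` with
covariance matrix `!![S x x, S x x'; S x' x, S x' x']`. -/
def gaussExp {E : Type*} (S : E → E → ℝ) (φ : ℝ → ℝ) (x x' : E) : ℝ :=
  ∫ v : EuclideanSpace ℝ (Fin 2), φ (v 0) * φ (v 1)
    ∂(multivariateGaussian 0 !![S x x, S x x'; S x' x, S x' x'])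

/-- The covariance kernels: `Sig σ β H` is `Σ^{(H+1)}`, the one of depth `L = H + 1`. -/
def Sig (σ : ℝ → ℝ) (β : ℝ) {n₀ : ℕ} : ℕ → (Fin n₀ → ℝ) → (Fin n₀ → ℝ) → ℝ
  | 0 => fun x x' => 1 / (n₀ : ℝ) * ∑ i, x i * x' i + β ^ 2
  | H + 1 => fun x x' => gaussExp (Sig σ β H) σ x x' + β ^ 2

/-- `SigDot σ β H` is `Σ̇^{(H+2)}`, the Gaussian expectation of `σ̇(f(x)) σ̇(f(x'))` for `f` of
covariance `Σ^{(H+1)}`. -/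
def SigDot (σ : ℝ → ℝ) (β : ℝ) {n₀ : ℕ} (H : ℕ) : (Fin n₀ → ℝ) → (Fin n₀ → ℝ) → ℝ :=
  fun x x' => gaussExp (Sig σ β H) (deriv σ) x x'

/-- The limiting scalar kernels: `limitNTK σ β H` is `Θ_∞^{(H+1)}`, the one of depth `L = H + 1`. -/
def limitNTK (σ : ℝ → ℝ) (β : ℝ) {n₀ : ℕ} : ℕ → (Fin n₀ → ℝ) → (Fin n₀ → ℝ) → ℝ
  | 0 => fun x x' => Sig σ β 0 x x'
  | H + 1 => fun x x' => limitNTK σ β H x x' * SigDot σ β H x x' + Sig σ β (H + 1) x x'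

/-- `K ⊗ Id_m`, for a scalar kernel `K`. -/
def tensorId {n₀ : ℕ} (K : (Fin n₀ → ℝ) → (Fin n₀ → ℝ) → ℝ) (m : ℕ) : MatKernel n₀ m :=
  fun x x' => K x x' • (1 : Matrix (Fin m) (Fin m) ℝ)

/-- The filter of the sequential limit `n₁ → ∞`, then `n₂ → ∞`, …, then `n_H → ∞`, on the lists
`[n_H, …, n₁]`. A property holds eventually along it iff
`∀ᶠ n_H, ∀ᶠ n_{H-1}, …, ∀ᶠ n₁` it holds; so a real-valued `p ≥ 0` tends to `0` along it iff
`limsup_{n_H} ⋯ limsup_{n₁} p(n₁, …, n_H) = 0`. -/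
def seqAtTop : ℕ → Filter (List ℕ)
  | 0 => pure []
  | H + 1 => (atTop : Filter ℕ).bind fun w => (seqAtTop H).map fun ws => w :: ws

/-- The squared seminorm `‖f‖²` of `f : ℝ^{n₀} → ℝ^m` for the empirical distribution of the dataset
`X`. -/
def inNormSq {n₀ m N : ℕ} (X : Fin N → Fin n₀ → ℝ) (f : (Fin n₀ → ℝ) → Fin m → ℝ) : ℝ :=
  1 / (N : ℝ) * ∑ i, f (X i) ⬝ᵥ f (X i)

/-- The quadratic form `⟨f, f⟩_K = E[f(x)ᵀ K(x, x') f(x')]`, for `x, x'` independent with the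
empirical distribution of the dataset `X`. -/
def kernelForm {n₀ m N : ℕ} (X : Fin N → Fin n₀ → ℝ) (K : MatKernel n₀ m)
    (f : (Fin n₀ → ℝ) → Fin m → ℝ) : ℝ :=
  1 / (N : ℝ) ^ 2 * ∑ i, ∑ j, f (X i) ⬝ᵥ (K (X i) (X j)).mulVec (f (X j))

/-- The operator norm of a kernel with respect to the empirical distribution of the dataset `X`:
the supremum of `√|⟨f, f⟩_K|` over `‖f‖ ≤ 1`. (The absolute value is there because a difference of
two positive semidefinite kernels need not be positive semidefinite.) -/
def kernelOpNorm {n₀ m N : ℕ} (X : Fin N → Fin n₀ → ℝ) (K : MatKernel n₀ m) : ℝ :=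
  sSup {r | ∃ f : (Fin n₀ → ℝ) → Fin m → ℝ, inNormSq X f ≤ 1 ∧ r = √|kernelForm X K f|}

end

end NTK

namespace NTK

/-! Condition on all layers but the last. At two inputs, the outputs of the last layer are then
independent copies of one Gaussian pair, whose covariances are the averages of `σ σ` over the last
hidden layer plus `β ^ 2`. Three consequences carry the proof.

Law of large numbers (`network_average`). By Chebyshev, an average of an observable `ψ` over `w`
output neurons is close to the Gaussian expectation of `ψ` for the conditional covariance, with
error probability of order `1 / w`. By induction that covariance is close to the limiting one, and
continuity of Gaussian expectations in the covariance finishes. The constant in Chebyshev's bound is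
locally bounded in the covariance, so `w` can be fixed before the earlier widths are sent to
infinity. This is applied to `σ σ` and to `σ̇ σ̇`. The second observable may be discontinuous. Since
the bias keeps all variances above `β ^ 2 > 0`, the marginal laws near a given covariance are
dominated by a single Gaussian, and continuity survives (`continuousOn_pairExp_deriv`).

Almost sure differentiability. For the same reason each preactivation has a density and avoids the
null set where `σ` is not differentiable. The chain rule is then valid almost surely.

Recursion (`ntk_cons`). The parameters of the last layer contribute `δ_kk'` times the empirical
covariance. The earlier ones contribute `(1 / w) ∑ i j, W_ik W_jk' σ̇_i σ̇'_j Θ_ij`, where `Θ` is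
the kernel of the subnetwork. With `w` fixed, induction replaces `Θ_ij` by `Θ_∞ δ_ij`. The remaining
diagonal average concentrates because the weights are independent of the preactivations: `W_ik
W_ik'` averages to `δ_kk'`, and `σ̇ σ̇'` averages to `Σ̇`. The decomposition of the error is
`ntk_sub_eq`, and the induction is `ntk_eventually`. On a finite dataset the operator norm is
controlled by finitely many entries. -/

/-- The law of a centered Gaussian pair with variances `s`, `s'` and covariance `r`. -/
noncomputable def pairLaw (s r s' : ℝ) : Measure (EuclideanSpace ℝ (Fin 2)) :=
  multivariateGaussian 0 !![s, r; r, s']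

instance isProbabilityMeasure_pairLaw (s r s' : ℝ) : IsProbabilityMeasure (pairLaw s r s') := by
  unfold pairLaw; infer_instance

/-! ### Gaussian pairs as linear images of independent standard Gaussians -/

theorem posSemidef_of_sq_le {s r s' : ℝ} (hs : 0 ≤ s) (hs' : 0 ≤ s') (h : r ^ 2 ≤ s * s') :
    (!![s, r; r, s'] : Matrix (Fin 2) (Fin 2) ℝ).PosSemidef := by
  refine Matrix.PosSemidef.of_dotProduct_mulVec_nonneg ?_ fun v => ?_
  · ext i j
    fin_cases i <;> fin_cases j <;> simp
  · simp only [star_trivial, Matrix.mulVec, dotProduct, Fin.sum_univ_two, Matrix.of_apply,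
      Matrix.cons_val', Matrix.cons_val_zero, Matrix.cons_val_one, Matrix.cons_val_fin_one]
    rcases hs.eq_or_lt with rfl | hs0
    · have : r = 0 := by nlinarith
      subst this
      nlinarith [mul_nonneg hs' (sq_nonneg (v 1))]
    -- Complete the square in the quadratic form multiplied by `s > 0`.
    · have h1 : 0 ≤ (s * v 0 + r * v 1) ^ 2 + (s * s' - r ^ 2) * v 1 ^ 2 := by
        have := mul_nonneg (sub_nonneg.2 h) (sq_nonneg (v 1)); positivity
      have h2 : (s * v 0 + r * v 1) ^ 2 + (s * s' - r ^ 2) * v 1 ^ 2 =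
        s * (v 0 * (s * v 0 + r * v 1) + v 1 * (r * v 0 + s' * v 1)) := by ring
      rw [h2] at h1
      exact nonneg_of_mul_nonneg_right h1 hs0

theorem sum_mul_sq_le {ι : Type*} [Fintype ι] (A B : ι → ℝ) :
    (∑ i, A i * B i) ^ 2 ≤ (∑ i, A i * A i) * ∑ i, B i * B i := by
  simpa [pow_two] using Finset.sum_mul_sq_le_sq_mul_sq Finset.univ A B

/-- Two linear forms in iid standard Gaussians are a Gaussian pair. -/
theorem map_pi_gaussianReal {ι : Type*} [Fintype ι] (A B : ι → ℝ) :
    (Measure.pi fun _ : ι => gaussianReal 0 1).map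
      (fun g => (!₂[∑ i, A i * g i, ∑ i, B i * g i] : EuclideanSpace ℝ (Fin 2))) =
    pairLaw (∑ i, A i * A i) (∑ i, A i * B i) (∑ i, B i * B i) := by
  have hm : Measurable (fun g : ι → ℝ =>
      (!₂[∑ i, A i * g i, ∑ i, B i * g i] : EuclideanSpace ℝ (Fin 2))) := by
    fun_prop
  have : IsProbabilityMeasure ((Measure.pi fun _ : ι => gaussianReal 0 1).map
      (fun g => (!₂[∑ i, A i * g i, ∑ i, B i * g i] : EuclideanSpace ℝ (Fin 2)))) :=
    Measure.isProbabilityMeasure_map hm.aemeasurable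
  -- The inner product with `t` is linear in `g`, so the characteristic function factors into
  -- one-dimensional Gaussian ones.
  refine Measure.ext_of_charFun (funext fun t => ?_)
  rw [pairLaw, charFun_multivariateGaussian (posSemidef_of_sq_le
    (Finset.sum_nonneg fun i _ => mul_self_nonneg _)
    (Finset.sum_nonneg fun i _ => mul_self_nonneg _) (sum_mul_sq_le A B)),
    charFun_apply, integral_map hm.aemeasurable (by fun_prop)]
  have h1 : ∀ g : ι → ℝ, Complex.exp (inner ℝ (!₂[∑ i, A i * g i, ∑ i, B i * g i] :
      EuclideanSpace ℝ (Fin 2)) t * Complex.I) =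
      ∏ i, Complex.exp ((A i * t 0 + B i * t 1 : ℝ) * g i * Complex.I) := by
    intro g
    rw [← Complex.exp_sum]
    congr 1
    simp only [PiLp.inner_apply, Fin.sum_univ_two, RCLike.inner_apply, conj_trivial]
    simp only [← Finset.sum_mul]
    congr 1
    norm_cast
    simp [Finset.mul_sum, add_mul, Finset.sum_add_distrib]
    congr 1 <;> exact Finset.sum_congr rfl fun i _ => by ring
  simp_rw [h1]
  rw [integral_fintype_prod_eq_prod (μ := fun _ : ι => gaussianReal 0 1)
    (fun i (y : ℝ) => Complex.exp ((A i * t 0 + B i * t 1 : ℝ) * y * Complex.I))]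
  simp_rw [← charFun_apply_real, charFun_gaussianReal]
  rw [← Complex.exp_sum]
  congr 1
  simp only [Matrix.mulVec, dotProduct, Fin.sum_univ_two, Matrix.of_apply,
      Matrix.cons_val', Matrix.cons_val_zero, Matrix.cons_val_one, Matrix.cons_val_fin_one]
  simp only [inner_zero_right]
  push_cast
  simp only [mul_zero, zero_mul, zero_sub, Finset.sum_mul, Finset.mul_sum, one_mul,
    ← Finset.sum_add_distrib, ← Finset.sum_neg_distrib, Finset.sum_div]
  exact Finset.sum_congr rfl fun i _ => by ring

theorem integral_pi_gaussianReal {ι : Type*} [Fintype ι] (A B : ι → ℝ) {ψ : ℝ → ℝ → ℝ}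
    (hψ : Measurable (Function.uncurry ψ)) :
    ∫ g, ψ (∑ i, A i * g i) (∑ i, B i * g i) ∂(Measure.pi fun _ : ι => gaussianReal 0 1) =
    ∫ v, ψ (v 0) (v 1) ∂pairLaw (∑ i, A i * A i) (∑ i, A i * B i) (∑ i, B i * B i) := by
  rw [← map_pi_gaussianReal, integral_map (by fun_prop)]
  · simp
  · have : Measurable fun v : EuclideanSpace ℝ (Fin 2) => ψ (v 0) (v 1) :=
      hψ.comp (Measurable.prodMk (by fun_prop) (by fun_prop))
    exact this.aestronglyMeasurable

/-- Cholesky factorization: a Gaussian pair in terms of two independent standard Gaussians. -/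
theorem map_cholesky {s r s' : ℝ} (hs : 0 < s) (h : r ^ 2 ≤ s * s') :
    (Measure.pi fun _ : Fin 2 => gaussianReal 0 1).map
      (fun g => (!₂[√s * g 0, r / √s * g 0 + √(s' - r ^ 2 / s) * g 1] :
        EuclideanSpace ℝ (Fin 2))) = pairLaw s r s' := by
  have h0 : 0 ≤ s' - r ^ 2 / s := by
    rw [sub_nonneg, div_le_iff₀ hs]; linarith
  have := map_pi_gaussianReal ![√s, 0] ![r / √s, √(s' - r ^ 2 / s)]
  simp only [Fin.sum_univ_two, Matrix.cons_val_zero, Matrix.cons_val_one, zero_mul, add_zero,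
    Real.mul_self_sqrt hs.le, Real.mul_self_sqrt h0, mul_zero] at this
  rw [this]
  have hne : √s ≠ 0 := (Real.sqrt_pos.2 hs).ne'
  have h1 : √s * (r / √s) = r := by field_simp
  have h2 : r / √s * (r / √s) = r ^ 2 / s := by
    rw [div_mul_div_comm, Real.mul_self_sqrt hs.le, pow_two]
  rw [h1, h2]
  congr 1
  ring

theorem measurePreserving_fst_pairLaw {s r s' : ℝ} (hs : 0 ≤ s) (hs' : 0 ≤ s')
    (h : r ^ 2 ≤ s * s') :
    MeasurePreserving (fun v => v 0) (pairLaw s r s') (gaussianReal 0 s.toNNReal) := by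
  simpa [pairLaw] using measurePreserving_eval_multivariateGaussian (μ := 0)
    (posSemidef_of_sq_le hs hs' h) (i := 0)

theorem measurePreserving_snd_pairLaw {s r s' : ℝ} (hs : 0 ≤ s) (hs' : 0 ≤ s')
    (h : r ^ 2 ≤ s * s') :
    MeasurePreserving (fun v => v 1) (pairLaw s r s') (gaussianReal 0 s'.toNNReal) := by
  simpa [pairLaw] using measurePreserving_eval_multivariateGaussian (μ := 0)
    (posSemidef_of_sq_le hs hs' h) (i := 1)

/-! ### Covariance data and second moments of observables -/

/-- The fourth moment of the standard Gaussian law. -/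
noncomputable def fourthMoment : ℝ := ∫ z, z ^ 4 ∂gaussianReal 0 1

theorem integrable_pow_gaussianReal (v : NNReal) (p : ℕ) :
    Integrable (fun z => z ^ p) (gaussianReal 0 v) := by
  simpa using (memLp_id_gaussianReal (μ := 0) (v := v) p).integrable_norm_pow'.mono'
    (f := fun z : ℝ => z ^ p) (by fun_prop) (by simp)

theorem integral_pow_four_gaussianReal {s : ℝ} (hs : 0 ≤ s) :
    ∫ z, z ^ 4 ∂gaussianReal 0 s.toNNReal = fourthMoment * s ^ 2 := by
  have : gaussianReal 0 s.toNNReal = (gaussianReal 0 1).map (√s * ·) := by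
    rw [gaussianReal_map_const_mul]
    simp only [mul_zero, mul_one]
    congr 1
    ext
    simp [Real.sq_sqrt hs, hs]
  rw [this, integral_map (by fun_prop) (by fun_prop), fourthMoment, ← integral_mul_const]
  congr 1
  ext z
  rw [mul_pow, show √s ^ 4 = (√s ^ 2) ^ 2 by ring, Real.sq_sqrt hs]
  ring

/-- The covariance data `(s, r, s')` of Gaussian pairs with variances at least `b`. -/
def covSet (b : ℝ) : Set (ℝ × ℝ × ℝ) :=
  {p | b ≤ p.1 ∧ b ≤ p.2.2 ∧ p.2.1 ^ 2 ≤ p.1 * p.2.2}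

/-- The expectation of `ψ (f, f')` for a Gaussian pair `(f, f')` with covariance data `p`. -/
noncomputable def pairExp (ψ : ℝ → ℝ → ℝ) (p : ℝ × ℝ × ℝ) : ℝ :=
  ∫ v, ψ (v 0) (v 1) ∂pairLaw p.1 p.2.1 p.2.2

theorem measurable_comp_pair {ψ : ℝ → ℝ → ℝ} (hψ : Measurable (Function.uncurry ψ)) :
    Measurable fun v : EuclideanSpace ℝ (Fin 2) => ψ (v 0) (v 1) :=
  hψ.comp (Measurable.prodMk (by fun_prop) (by fun_prop))

/-- A bound for the second moment of a function of quadratic growth of a Gaussian pair. -/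
noncomputable def sqBound (K : ℝ) (p : ℝ × ℝ × ℝ) : ℝ :=
  3 * K ^ 2 * (1 + fourthMoment * p.1 ^ 2 + fourthMoment * p.2.2 ^ 2)

theorem continuous_sqBound (K : ℝ) : Continuous (sqBound K) := by
  unfold sqBound; fun_prop

section Moments

variable {b K : ℝ} {p : ℝ × ℝ × ℝ} {ψ : ℝ → ℝ → ℝ}

/-- Cauchy–Schwarz for the three terms `1`, `u ^ 2`, `v ^ 2`, whence the constant `3`. -/
theorem sq_le_of_growth {u v y : ℝ} (h : |y| ≤ K * (1 + u ^ 2 + v ^ 2)) :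
    y ^ 2 ≤ 3 * K ^ 2 * (1 + u ^ 4 + v ^ 4) := by
  have h1 : y ^ 2 ≤ (K * (1 + u ^ 2 + v ^ 2)) ^ 2 := by
    rw [← sq_abs]; exact pow_le_pow_left₀ (abs_nonneg _) h 2
  have h2 : (1 + u ^ 2 + v ^ 2) ^ 2 ≤ 3 * (1 + u ^ 4 + v ^ 4) := by
    nlinarith [sq_nonneg (u ^ 2 - 1), sq_nonneg (v ^ 2 - 1), sq_nonneg (u ^ 2 - v ^ 2)]
  calc y ^ 2 ≤ K ^ 2 * (1 + u ^ 2 + v ^ 2) ^ 2 := by rw [← mul_pow]; exact h1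
    _ ≤ K ^ 2 * (3 * (1 + u ^ 4 + v ^ 4)) := by gcongr
    _ = _ := by ring

theorem integrable_pow_four_pairLaw (hb : 0 < b) (hp : p ∈ covSet b) (i : Fin 2) :
    Integrable (fun v => v i ^ 4) (pairLaw p.1 p.2.1 p.2.2) := by
  fin_cases i
  · exact (measurePreserving_fst_pairLaw (hb.le.trans hp.1) (hb.le.trans hp.2.1)
      hp.2.2).integrable_comp_of_integrable (integrable_pow_gaussianReal _ 4)
  · exact (measurePreserving_snd_pairLaw (hb.le.trans hp.1) (hb.le.trans hp.2.1)
      hp.2.2).integrable_comp_of_integrable (integrable_pow_gaussianReal _ 4)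

theorem integrable_growth_bound (hb : 0 < b) (hp : p ∈ covSet b) :
    Integrable (fun v : EuclideanSpace ℝ (Fin 2) => 3 * K ^ 2 * (1 + v 0 ^ 4 + v 1 ^ 4))
      (pairLaw p.1 p.2.1 p.2.2) :=
  (((integrable_const _).add (integrable_pow_four_pairLaw hb hp 0)).add
    (integrable_pow_four_pairLaw hb hp 1)).const_mul _

theorem integrable_sq_of_growth (hb : 0 < b) (hp : p ∈ covSet b)
    (hψ : Measurable (Function.uncurry ψ)) (hK : ∀ u v, |ψ u v| ≤ K * (1 + u ^ 2 + v ^ 2)) :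
    Integrable (fun v => ψ (v 0) (v 1) ^ 2) (pairLaw p.1 p.2.1 p.2.2) := by
  refine (integrable_growth_bound (K := K) hb hp).mono'
    ((measurable_comp_pair hψ).pow_const 2).aestronglyMeasurable (ae_of_all _ fun v => ?_)
  rw [Real.norm_eq_abs, abs_of_nonneg (sq_nonneg _)]
  exact sq_le_of_growth (hK _ _)

theorem memLp_of_growth (hb : 0 < b) (hp : p ∈ covSet b)
    (hψ : Measurable (Function.uncurry ψ)) (hK : ∀ u v, |ψ u v| ≤ K * (1 + u ^ 2 + v ^ 2)) :
    MemLp (fun v : EuclideanSpace ℝ (Fin 2) => ψ (v 0) (v 1)) 2 (pairLaw p.1 p.2.1 p.2.2) :=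
  (memLp_two_iff_integrable_sq (measurable_comp_pair hψ).aestronglyMeasurable).2
    (integrable_sq_of_growth hb hp hψ hK)

/-- Only the marginal fourth moments enter, so the bound is an explicit continuous function of the
two variances. This makes the constant in Chebyshev's inequality uniform near the limiting
covariance. -/
theorem integral_sq_le_sqBound (hb : 0 < b) (hp : p ∈ covSet b)
    (hψ : Measurable (Function.uncurry ψ)) (hK : ∀ u v, |ψ u v| ≤ K * (1 + u ^ 2 + v ^ 2)) :
    ∫ v, ψ (v 0) (v 1) ^ 2 ∂pairLaw p.1 p.2.1 p.2.2 ≤ sqBound K p := by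
  have hs := hb.le.trans hp.1
  have hs' := hb.le.trans hp.2.1
  refine (integral_mono (integrable_sq_of_growth hb hp hψ hK) (integrable_growth_bound hb hp)
    fun v => sq_le_of_growth (hK _ _)).trans_eq ?_
  have h0 : ∫ v, v 0 ^ 4 ∂pairLaw p.1 p.2.1 p.2.2 = fourthMoment * p.1 ^ 2 := by
    rw [← integral_pow_four_gaussianReal hs, ← (measurePreserving_fst_pairLaw hs hs' hp.2.2).map_eq,
      integral_map (by fun_prop) (by fun_prop)]
  have h1 : ∫ v, v 1 ^ 4 ∂pairLaw p.1 p.2.1 p.2.2 = fourthMoment * p.2.2 ^ 2 := by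
    rw [← integral_pow_four_gaussianReal hs', ← (measurePreserving_snd_pairLaw hs hs' hp.2.2).map_eq,
      integral_map (by fun_prop) (by fun_prop)]
  rw [integral_const_mul, integral_add (f := fun v : EuclideanSpace ℝ (Fin 2) => 1 + v 0 ^ 4)
    ((integrable_const _).add (integrable_pow_four_pairLaw hb hp 0))
    (integrable_pow_four_pairLaw hb hp 1), integral_add (integrable_const _)
    (integrable_pow_four_pairLaw hb hp 0), h0, h1]
  simp [sqBound]

end Moments

/-! ### Continuity of Gaussian expectations in the covariance -/

section Continuity

variable {b : ℝ}

/-- Moves the dependence on `p` from the law to the integrand, so that dominated convergence applies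
under one fixed law. -/
theorem pairExp_eq_cholesky (hb : 0 < b) {ψ : ℝ → ℝ → ℝ}
    (hψ : Measurable (Function.uncurry ψ)) {p : ℝ × ℝ × ℝ} (hp : p ∈ covSet b) :
    pairExp ψ p = ∫ g, ψ (√p.1 * g 0) (p.2.1 / √p.1 * g 0 + √(p.2.2 - p.2.1 ^ 2 / p.1) * g 1)
      ∂(Measure.pi fun _ : Fin 2 => gaussianReal 0 1) := by
  rw [pairExp, ← map_cholesky (hb.trans_le hp.1) hp.2.2, integral_map (by fun_prop)
    (measurable_comp_pair hψ).aestronglyMeasurable]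
  simp

theorem continuousOn_pairExp (hb : 0 < b) {ψ : ℝ → ℝ → ℝ} {K : ℝ}
    (hψ : Continuous (Function.uncurry ψ)) (hK : ∀ u v, |ψ u v| ≤ K * (1 + u ^ 2 + v ^ 2)) :
    ContinuousOn (pairExp ψ) (covSet b) := by
  have hK0 : 0 ≤ K := by simpa using (abs_nonneg _).trans (hK 0 0)
  refine ContinuousOn.congr ?_ fun p hp => pairExp_eq_cholesky hb hψ.measurable hp
  intro p₀ hp₀
  set M : ℝ := p₀.1 + p₀.2.2 + 1
  have hp1 : 0 < p₀.1 := hb.trans_le hp₀.1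
  have hp2 : 0 < p₀.2.2 := hb.trans_le hp₀.2.1
  have hM : 0 ≤ M := by positivity
  have hint : ∀ i : Fin 2, Integrable (fun g : Fin 2 → ℝ => g i ^ 2)
      (Measure.pi fun _ : Fin 2 => gaussianReal 0 1) := fun i =>
    (measurePreserving_eval (fun _ : Fin 2 => gaussianReal 0 1) i).integrable_comp_of_integrable
      (integrable_pow_gaussianReal 1 2)
  -- Near `p₀` both variances stay below `M`. On `covSet b` also `p.2.1 ^ 2 / p.1 ≤ p.2.2`, so each
  -- of the two terms of the second coordinate has coefficient squared at most `M`; the factor `2`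
  -- comes from squaring their sum.
  refine continuousWithinAt_of_dominated
    (bound := fun g => K * (1 + M * g 0 ^ 2 + 2 * M * (g 0 ^ 2 + g 1 ^ 2))) ?_ ?_ ?_ ?_
  · refine Eventually.of_forall fun p => Measurable.aestronglyMeasurable ?_
    exact hψ.measurable.comp (Measurable.prodMk (by fun_prop) (by fun_prop))
  · have h1 : ∀ᶠ p : ℝ × ℝ × ℝ in 𝓝 p₀, p.1 < M :=
      continuous_fst.continuousAt.eventually_lt_const (by simp only [M]; linarith)
    have h2 : ∀ᶠ p : ℝ × ℝ × ℝ in 𝓝 p₀, p.2.2 < M :=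
      (continuous_snd.comp continuous_snd).continuousAt.eventually_lt_const
        (by simp only [M, Function.comp]; linarith)
    filter_upwards [nhdsWithin_le_nhds h1, nhdsWithin_le_nhds h2, self_mem_nhdsWithin]
      with p h1 h2 hp
    refine ae_of_all _ fun g => (hK _ _).trans ?_
    have hs : 0 < p.1 := hb.trans_le hp.1
    have hq : p.2.1 ^ 2 / p.1 ≤ p.2.2 := by
      rw [div_le_iff₀ hs]; linarith [hp.2.2]
    have hq0 : 0 ≤ p.2.1 ^ 2 / p.1 := by positivity
    have e1 : (√p.1 * g 0) ^ 2 ≤ M * g 0 ^ 2 := by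
      rw [mul_pow, Real.sq_sqrt hs.le]; gcongr
    have e2 : (p.2.1 / √p.1 * g 0 + √(p.2.2 - p.2.1 ^ 2 / p.1) * g 1) ^ 2 ≤
        2 * M * (g 0 ^ 2 + g 1 ^ 2) := by
      have a1 : (p.2.1 / √p.1 * g 0) ^ 2 ≤ M * g 0 ^ 2 := by
        rw [mul_pow, div_pow, Real.sq_sqrt hs.le]
        gcongr; linarith
      have a2 : (√(p.2.2 - p.2.1 ^ 2 / p.1) * g 1) ^ 2 ≤ M * g 1 ^ 2 := by
        rw [mul_pow, Real.sq_sqrt (by linarith)]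
        gcongr; linarith
      refine (add_sq_le (a := p.2.1 / √p.1 * g 0)).trans ?_
      linarith
    gcongr
  · exact (((integrable_const _).add ((hint 0).const_mul _)).add
      (((hint 0).add (hint 1)).const_mul _)).const_mul _
  · refine ae_of_all _ fun g => ContinuousAt.continuousWithinAt ?_
    have hne : √p₀.1 ≠ 0 := (Real.sqrt_pos.2 hp1).ne'
    have hne' : p₀.1 ≠ 0 := hp1.ne'
    have : ContinuousAt (fun p : ℝ × ℝ × ℝ =>
        (√p.1 * g 0, p.2.1 / √p.1 * g 0 + √(p.2.2 - p.2.1 ^ 2 / p.1) * g 1)) p₀ := by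
      fun_prop (disch := assumption)
    exact ContinuousAt.comp (g := Function.uncurry ψ) hψ.continuousAt this

/-- For variances in `[b, M]` the exponential factor of the density is largest at `M`, and the
normalizing constants differ by a factor at most `√(M / b)`. -/
theorem gaussianReal_le_smul {s M : ℝ} (hb : 0 < b) (hs : b ≤ s) (hM : s ≤ M) :
    gaussianReal 0 s.toNNReal ≤ ENNReal.ofReal (√(M / b)) • gaussianReal 0 M.toNNReal := by
  have hs0 : 0 < s := hb.trans_le hs
  have hM0 : 0 < M := hs0.trans_le hM
  rw [gaussianReal_of_var_ne_zero _ (by simpa using hs0),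
    gaussianReal_of_var_ne_zero _ (by simpa using hM0), ← withDensity_smul _ (by fun_prop)]
  refine withDensity_mono (ae_of_all _ fun x => ?_)
  simp only [Pi.smul_apply, smul_eq_mul, gaussianPDF]
  rw [← ENNReal.ofReal_mul (by positivity)]
  apply ENNReal.ofReal_le_ofReal
  simp only [gaussianPDFReal, sub_zero, Real.coe_toNNReal _ hs0.le, Real.coe_toNNReal _ hM0.le]
  rw [← mul_assoc]
  have h1 : (√(2 * Real.pi * s))⁻¹ ≤ √(M / b) * (√(2 * Real.pi * M))⁻¹ := by
    rw [← Real.sqrt_inv, ← Real.sqrt_inv, ← Real.sqrt_mul (by positivity)]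
    apply Real.sqrt_le_sqrt
    have : M / b * (2 * Real.pi * M)⁻¹ = (2 * Real.pi * b)⁻¹ := by
      field_simp
    rw [this]
    gcongr
  have h2 : Real.exp (-x ^ 2 / (2 * s)) ≤ Real.exp (-x ^ 2 / (2 * M)) := by
    apply Real.exp_le_exp.2
    rw [neg_div, neg_div, neg_le_neg_iff]
    gcongr
  gcongr

theorem integrable_of_abs_le {α : Type*} [MeasurableSpace α] {μ : Measure α} [IsFiniteMeasure μ]
    {f : α → ℝ} {c : ℝ} (hf : Measurable f) (hc : ∀ x, |f x| ≤ c) : Integrable f μ :=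
  (integrable_const c).mono' hf.aestronglyMeasurable (ae_of_all _ hc)

/-- Telescoping the difference of products leaves a bounded factor times a difference in a single
variable, so only the marginals matter. This is essential because the joint law may be singular, for
instance when the two inputs coincide. -/
theorem abs_pairExp_sub_le (hb : 0 < b) {φ g : ℝ → ℝ} {c M : ℝ} (hφ : Measurable φ)
    (hg : Measurable g) (hφc : ∀ u, |φ u| ≤ c) (hgc : ∀ u, |g u| ≤ c) {p : ℝ × ℝ × ℝ}
    (hp : p ∈ covSet b) (h1 : p.1 ≤ M) (h2 : p.2.2 ≤ M) :
    |pairExp (fun u v => φ u * φ v) p - pairExp (fun u v => g u * g v) p| ≤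
      2 * c * √(M / b) * ∫ z, |φ z - g z| ∂gaussianReal 0 M.toNNReal := by
  have hc0 : 0 ≤ c := (abs_nonneg _).trans (hφc 0)
  have hs := hb.le.trans hp.1
  have hs' := hb.le.trans hp.2.1
  have hd : Measurable fun z => |φ z - g z| := by fun_prop
  have hdc : ∀ z, |(|φ z - g z|)| ≤ c + c := fun z => by
    rw [abs_abs]; exact (abs_sub _ _).trans (add_le_add (hφc z) (hgc z))
  have key : ∀ s, b ≤ s → s ≤ M → ∫ z, |φ z - g z| ∂gaussianReal 0 s.toNNReal ≤
      √(M / b) * ∫ z, |φ z - g z| ∂gaussianReal 0 M.toNNReal := by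
    intro s hs hM
    refine (integral_mono_measure (gaussianReal_le_smul hb hs hM)
      (ae_of_all _ fun z => abs_nonneg _) ?_).trans_eq ?_
    · exact (integrable_of_abs_le hd hdc).smul_measure ENNReal.ofReal_ne_top
    · rw [integral_smul_measure, ENNReal.toReal_ofReal (Real.sqrt_nonneg _), smul_eq_mul]
  have hm : ∀ {f : ℝ → ℝ}, Measurable f → ∀ i : Fin 2,
      Measurable fun v : EuclideanSpace ℝ (Fin 2) => f (v i) := fun hf i =>
    hf.comp (by fun_prop)
  have hprod : ∀ {f : ℝ → ℝ}, (∀ u, |f u| ≤ c) → ∀ u v, |f u * f v| ≤ c * c := fun hf u v => by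
    rw [abs_mul]; exact mul_le_mul (hf u) (hf v) (abs_nonneg _) hc0
  have hi : ∀ {f : ℝ → ℝ}, Measurable f → (∀ u, |f u| ≤ c) →
      Integrable (fun v : EuclideanSpace ℝ (Fin 2) => f (v 0) * f (v 1))
        (pairLaw p.1 p.2.1 p.2.2) := fun hf hfc =>
    integrable_of_abs_le ((hm hf 0).mul (hm hf 1)) fun v => hprod hfc _ _
  rw [pairExp, pairExp, ← integral_sub (hi hφ hφc) (hi hg hgc)]
  refine (abs_integral_le_integral_abs).trans ?_
  have hle : ∀ v : EuclideanSpace ℝ (Fin 2), |φ (v 0) * φ (v 1) - g (v 0) * g (v 1)| ≤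
      c * (|φ (v 0) - g (v 0)| + |φ (v 1) - g (v 1)|) := by
    intro v
    have : φ (v 0) * φ (v 1) - g (v 0) * g (v 1) =
      φ (v 1) * (φ (v 0) - g (v 0)) + g (v 0) * (φ (v 1) - g (v 1)) := by ring
    rw [this, mul_add]
    refine (abs_add_le _ _).trans ?_
    rw [abs_mul, abs_mul]
    gcongr
    · exact hφc _
    · exact hgc _
  have i0 : Integrable (fun v : EuclideanSpace ℝ (Fin 2) => |φ (v 0) - g (v 0)|)
      (pairLaw p.1 p.2.1 p.2.2) := integrable_of_abs_le (hm hd 0) fun v => hdc _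
  have i1 : Integrable (fun v : EuclideanSpace ℝ (Fin 2) => |φ (v 1) - g (v 1)|)
      (pairLaw p.1 p.2.1 p.2.2) := integrable_of_abs_le (hm hd 1) fun v => hdc _
  refine (integral_mono_of_nonneg (ae_of_all _ fun v => abs_nonneg _)
    ((i0.add i1).const_mul c) (ae_of_all _ hle)).trans ?_
  simp only [Pi.add_apply]
  rw [integral_const_mul, integral_add i0 i1]
  have e0 : ∫ v, |φ (v 0) - g (v 0)| ∂pairLaw p.1 p.2.1 p.2.2 =
      ∫ z, |φ z - g z| ∂gaussianReal 0 p.1.toNNReal := by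
    rw [← (measurePreserving_fst_pairLaw hs hs' hp.2.2).map_eq,
      integral_map (by fun_prop) hd.aestronglyMeasurable]
  have e1 : ∫ v, |φ (v 1) - g (v 1)| ∂pairLaw p.1 p.2.1 p.2.2 =
      ∫ z, |φ z - g z| ∂gaussianReal 0 p.2.2.toNNReal := by
    rw [← (measurePreserving_snd_pairLaw hs hs' hp.2.2).map_eq,
      integral_map (by fun_prop) hd.aestronglyMeasurable]
  rw [e0, e1]
  have := mul_le_mul_of_nonneg_left (add_le_add (key _ hp.1 h1) (key _ hp.2.1 h2)) hc0
  linarith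

theorem abs_deriv_le {σ : ℝ → ℝ} {c : NNReal} (hσ : LipschitzWith c σ) (u : ℝ) :
    |deriv σ u| ≤ c := by
  simpa using norm_deriv_le_of_lipschitz (x₀ := u) hσ

/-- Gaussian expectations of the derivative of a Lipschitz function depend continuously on the
covariance, although the derivative need not be continuous: it is the almost everywhere limit of
difference quotients, and the marginal laws are uniformly dominated by one Gaussian law. -/
theorem continuousOn_pairExp_deriv (hb : 0 < b) {σ : ℝ → ℝ} {c : NNReal}
    (hσ : LipschitzWith c σ) :
    ContinuousOn (pairExp fun u v => deriv σ u * deriv σ v) (covSet b) := by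
  have hm : Measurable (deriv σ) := measurable_deriv σ
  -- Difference quotients with step `1 / (n + 1)`: continuous, bounded by the Lipschitz constant,
  -- and convergent to `deriv σ` wherever `σ` is differentiable.
  let q : ℕ → ℝ → ℝ := fun n u => ((n : ℝ) + 1) * (σ (u + ((n : ℝ) + 1)⁻¹) - σ u)
  have hqc : ∀ n, Continuous (q n) := fun n => by
    have := hσ.continuous
    fun_prop
  have hqb : ∀ n u, |q n u| ≤ c := by
    intro n u
    have h1 := hσ.dist_le_mul (u + ((n : ℝ) + 1)⁻¹) u
    have hn : (0 : ℝ) < (n : ℝ) + 1 := by positivity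
    rw [Real.dist_eq, Real.dist_eq, add_sub_cancel_left, abs_of_pos (inv_pos.2 hn)] at h1
    simp only [q, abs_mul, abs_of_pos hn]
    calc ((n : ℝ) + 1) * |σ (u + ((n : ℝ) + 1)⁻¹) - σ u|
        ≤ ((n : ℝ) + 1) * (c * ((n : ℝ) + 1)⁻¹) := by gcongr
      _ = c := by field_simp
  have hlim : ∀ᵐ u, Tendsto (fun n => q n u) atTop (𝓝 (deriv σ u)) := by
    filter_upwards [hσ.ae_differentiableAt_real] with u hu
    have h := hu.hasDerivAt.tendsto_slope_zero
    have hz : Tendsto (fun n : ℕ => ((n : ℝ) + 1)⁻¹) atTop (𝓝[≠] 0) := by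
      refine tendsto_nhdsWithin_iff.2 ⟨?_, Eventually.of_forall fun n => ?_⟩
      · simpa using tendsto_one_div_add_atTop_nhds_zero_nat (𝕜 := ℝ)
      · simp only [Set.mem_compl_iff, Set.mem_singleton_iff]; positivity
    refine (h.comp hz).congr fun n => ?_
    simp [q]
  intro p₀ hp₀
  -- Locally uniform limits preserve continuity. As long as both variances are below `M`, the error
  -- of replacing `deriv σ` by `q n` is bounded by an `L¹` distance under the law of variance `M`,
  -- which does not depend on `p`.
  refine continuousWithinAt_of_locally_uniform_approx_of_continuousWithinAt hp₀ fun U hU => ?_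
  obtain ⟨ε, hε, hεU⟩ := Metric.mem_uniformity_dist.1 hU
  set M : ℝ := p₀.1 + p₀.2.2 + 1
  have hp1 : 0 < p₀.1 := hb.trans_le hp₀.1
  have hp2 : 0 < p₀.2.2 := hb.trans_le hp₀.2.1
  have hM : 0 < M := by positivity
  have h1 : ∀ᶠ p : ℝ × ℝ × ℝ in 𝓝 p₀, p.1 < M :=
    continuous_fst.continuousAt.eventually_lt_const (by simp only [M]; linarith)
  have h2 : ∀ᶠ p : ℝ × ℝ × ℝ in 𝓝 p₀, p.2.2 < M :=
    (continuous_snd.comp continuous_snd).continuousAt.eventually_lt_const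
      (by simp only [M, Function.comp]; linarith)
  have hint : Tendsto (fun n => 2 * c * √(M / b) *
      ∫ z, |deriv σ z - q n z| ∂gaussianReal 0 M.toNNReal) atTop (𝓝 0) := by
    have : Tendsto (fun n => ∫ z, |deriv σ z - q n z| ∂gaussianReal 0 M.toNNReal) atTop
        (𝓝 (∫ z, (0 : ℝ) ∂gaussianReal 0 M.toNNReal)) := by
      refine tendsto_integral_of_dominated_convergence (fun _ => (c : ℝ) + c) (fun n => ?_)
        (integrable_const _) (fun n => ae_of_all _ fun z => ?_) ?_
      · exact ((hm.sub (hqc n).measurable).abs).aestronglyMeasurable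
      · rw [Real.norm_eq_abs, abs_abs]
        exact (abs_sub _ _).trans (add_le_add (abs_deriv_le hσ z) (hqb n z))
      -- Convergence Lebesgue almost everywhere suffices, since the Gaussian law of variance `M > 0`
      -- has a density.
      · filter_upwards [(gaussianReal_absolutelyContinuous 0
          (v := M.toNNReal) (by simpa using hM)).ae_le hlim] with z hz
        simpa using ((tendsto_const_nhds (x := deriv σ z)).sub hz).abs
    simpa using this.const_mul (2 * c * √(M / b))
  obtain ⟨n, hn⟩ := (hint.eventually_lt_const hε).exists
  refine ⟨{p | p.1 < M} ∩ {p | p.2.2 < M} ∩ covSet b,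
    inter_mem (inter_mem (nhdsWithin_le_nhds h1) (nhdsWithin_le_nhds h2)) self_mem_nhdsWithin,
    pairExp fun u v => q n u * q n v, ?_, fun p hp => hεU ?_⟩
  · refine continuousOn_pairExp hb (K := c * c) ?_ (fun u v => ?_) p₀ hp₀
    · exact ((hqc n).comp continuous_fst).mul ((hqc n).comp continuous_snd)
    · rw [abs_mul]
      have := mul_le_mul (hqb n u) (hqb n v) (abs_nonneg _) c.2
      refine this.trans ?_
      have : (0 : ℝ) ≤ c * c := by positivity
      nlinarith [mul_nonneg this (sq_nonneg u), mul_nonneg this (sq_nonneg v)]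
  · rw [Real.dist_eq]
    exact (abs_pairExp_sub_le hb hm (hqc n).measurable (abs_deriv_le hσ) (hqb n) hp.2
      hp.1.1.le hp.1.2.le).trans_lt hn

end Continuity

/-! ### Independence over disjoint coordinates and Chebyshev's inequality -/

section Chebyshev

/-- Functions of disjoint sets of independent coordinates are independent. -/
theorem indepFun_pi_of_disjoint {ι : Type*} [Fintype ι] (μ : ι → Measure ℝ)
    [∀ i, IsProbabilityMeasure (μ i)] {S T : Finset ι} (hST : Disjoint S T) {f h : (ι → ℝ) → ℝ}
    (hf : Measurable f) (hh : Measurable h)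
    (hfS : ∀ g g', (∀ i ∈ S, g i = g' i) → f g = f g')
    (hhT : ∀ g g', (∀ i ∈ T, g i = g' i) → h g = h g') : IndepFun f h (Measure.pi μ) := by
  classical
  have key := (iIndepFun_pi (μ := μ) (X := fun _ x => x) fun i => aemeasurable_id).indepFun_finset
    S T hST fun i => measurable_pi_apply i
  -- A function depending only on the coordinates in `U` factors through the restriction to `U`;
  -- extension by zero provides the measurable factorization.
  have hext : ∀ U : Finset ι, Measurable fun (u : U → ℝ) (i : ι) =>
      if hi : i ∈ U then u ⟨i, hi⟩ else 0 := fun U => by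
    refine measurable_pi_lambda _ fun i => ?_
    by_cases hi : i ∈ U <;> simp only [hi, dite_true, dite_false] <;> fun_prop
  refine (key.comp (hf.comp (hext S)) (hh.comp (hext T))).congr ?_ ?_
  · exact ae_of_all _ fun g => hfS _ _ fun i hi => by simp [hi]
  · exact ae_of_all _ fun g => hhT _ _ fun i hi => by simp [hi]

/-- **Chebyshev's inequality** for the average of pairwise independent random variables. -/
theorem measure_average_sub_ge_le {Ω : Type*} [MeasurableSpace Ω] {P : Measure Ω}
    [IsProbabilityMeasure P] {m : ℕ} (hm : 0 < m) {X : Fin m → Ω → ℝ} (hX : ∀ i, MemLp (X i) 2 P)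
    (hind : ∀ i j, i ≠ j → IndepFun (X i) (X j) P) {e V ε : ℝ} (he : ∀ i, ∫ ω, X i ω ∂P = e)
    (hV : ∀ i, ∫ ω, X i ω ^ 2 ∂P ≤ V) (hε : 0 < ε) :
    P {ω | ε ≤ |1 / (m : ℝ) * ∑ i, X i ω - e|} ≤ ENNReal.ofReal (V / (m * ε ^ 2)) := by
  have hm' : (0 : ℝ) < m := by exact_mod_cast hm
  set Y : Ω → ℝ := ∑ i, X i with hY
  have hYL : MemLp Y 2 P := memLp_finsetSum' _ fun i _ => hX i
  have hEY : ∫ ω, Y ω ∂P = m * e := by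
    simp only [hY, Finset.sum_apply]
    rw [integral_finsetSum _ fun i _ => (hX i).integrable (by norm_num)]
    simp [he]
  have hvar : variance Y P ≤ m * V := by
    rw [hY, IndepFun.variance_sum (fun i _ => hX i) fun i _ j _ hij => hind i j hij]
    calc ∑ i, variance (X i) P ≤ ∑ _i : Fin m, V :=
          Finset.sum_le_sum fun i _ => (variance_le_expectation_sq
            (hX i).aestronglyMeasurable).trans (by simpa using hV i)
      _ = m * V := by simp
  have hset : {ω | ε ≤ |1 / (m : ℝ) * ∑ i, X i ω - e|} ⊆
      {ω | m * ε ≤ |Y ω - ∫ ω, Y ω ∂P|} := by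
    intro ω hω
    rw [Set.mem_ofPred_eq] at hω ⊢
    rw [hEY, hY, Finset.sum_apply]
    have : ∑ i, X i ω - m * e = m * (1 / (m : ℝ) * ∑ i, X i ω - e) := by field_simp
    rw [this, abs_mul, abs_of_pos hm']
    gcongr
  refine (measure_mono hset).trans ((meas_ge_le_variance_div_sq hYL (by positivity)).trans ?_)
  apply ENNReal.ofReal_le_ofReal
  calc variance Y P / (m * ε) ^ 2 ≤ m * V / (m * ε) ^ 2 := by gcongr
    _ = V / (m * ε ^ 2) := by field_simp

end Chebyshev

/-! ### A single random layer with fixed inputs -/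

section Layer

/-- The law of the weights and biases of one layer at initialization. -/
noncomputable def layerLaw (n m : ℕ) : Measure ((Fin n × Fin m) ⊕ Fin m → ℝ) :=
  Measure.pi fun _ => gaussianReal 0 1

instance isProbabilityMeasure_layerLaw (n m : ℕ) : IsProbabilityMeasure (layerLaw n m) := by
  unfold layerLaw; infer_instance

/-- The output of a layer with weights and biases `g`. -/
noncomputable def layerOut {n m : ℕ} (β : ℝ) (g : (Fin n × Fin m) ⊕ Fin m → ℝ) (a : Fin n → ℝ)
    (k : Fin m) : ℝ :=
  layer β (fun i k => g (.inl (i, k))) (fun k => g (.inr k)) a k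

/-- The coefficients of the `k`-th output of a layer, as a linear form in the parameters. -/
noncomputable def layerCoeff {n m : ℕ} (β : ℝ) (a : Fin n → ℝ) (k : Fin m) :
    (Fin n × Fin m) ⊕ Fin m → ℝ :=
  Sum.elim (fun q => if q.2 = k then 1 / √(n : ℝ) * a q.1 else 0) fun j => if j = k then β else 0

/-- The covariance of the outputs of a layer at inputs `a` and `a'`. -/
noncomputable def layerCov {n : ℕ} (β : ℝ) (a a' : Fin n → ℝ) : ℝ :=
  1 / (n : ℝ) * ∑ i, a i * a' i + β ^ 2

/-- The covariance data of the pair of outputs of a layer at inputs `a` and `a'`. -/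
noncomputable def layerCovData {n : ℕ} (β : ℝ) (a a' : Fin n → ℝ) : ℝ × ℝ × ℝ :=
  (layerCov β a a, layerCov β a a', layerCov β a' a')

variable {n m : ℕ} {β : ℝ}

theorem layerOut_eq_sum (g : (Fin n × Fin m) ⊕ Fin m → ℝ) (a : Fin n → ℝ) (k : Fin m) :
    layerOut β g a k = ∑ q, layerCoeff β a k q * g q := by
  simp only [layerOut, layer, layerCoeff, Fintype.sum_sum_type, Fintype.sum_prod_type,
    Sum.elim_inl, Sum.elim_inr, ite_mul, zero_mul, Finset.sum_ite_eq', Finset.mem_univ, if_true,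
    Finset.mul_sum]
  congr 1
  exact Finset.sum_congr rfl fun i _ => by ring

theorem sum_layerCoeff_mul (a a' : Fin n → ℝ) (k : Fin m) :
    ∑ q, layerCoeff β a k q * layerCoeff β a' k q = layerCov β a a' := by
  simp only [layerCov, layerCoeff, Fintype.sum_sum_type, Fintype.sum_prod_type,
    Sum.elim_inl, Sum.elim_inr, ite_mul, zero_mul, Finset.sum_ite_eq', Finset.mem_univ, if_true,
    Finset.mul_sum, pow_two]
  congr 1
  refine Finset.sum_congr rfl fun i _ => ?_
  calc _ = (1 / √(n : ℝ) * (1 / √(n : ℝ))) * (a i * a' i) := by ring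
    _ = _ := by rw [div_mul_div_comm, one_mul, Real.mul_self_sqrt (Nat.cast_nonneg n)]

/-- The bias alone gives this bound, whatever the input and the width. It is what keeps the marginal
laws nondegenerate throughout. -/
theorem sq_le_layerCov_self (a : Fin n → ℝ) : β ^ 2 ≤ layerCov β a a := by
  have : 0 ≤ ∑ i, a i * a i := Finset.sum_nonneg fun i _ => mul_self_nonneg _
  simp only [layerCov, le_add_iff_nonneg_left]
  positivity

theorem layerCovData_mem (a a' : Fin n → ℝ) : layerCovData β a a' ∈ covSet (β ^ 2) := by
  refine ⟨sq_le_layerCov_self a, sq_le_layerCov_self a', ?_⟩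
  -- The covariances are Gram entries of coefficient vectors, so Cauchy–Schwarz applies; a layer
  -- with one output is enough to write them so.
  simp only [layerCovData, ← sum_layerCoeff_mul (m := 1) _ _ 0]
  exact sum_mul_sq_le _ _

theorem measurable_layerOut (a : Fin n → ℝ) (k : Fin m) :
    Measurable fun g => layerOut β g a k := by
  simp only [layerOut_eq_sum]; fun_prop

theorem measurable_layerOut_comp {α : Type*} [MeasurableSpace α]
    {g : α → (Fin n × Fin m) ⊕ Fin m → ℝ} {a : α → Fin n → ℝ} (hg : Measurable g)
    (ha : Measurable a) (k : Fin m) : Measurable fun q => layerOut β (g q) (a q) k := by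
  simp only [layerOut, layer]
  fun_prop

theorem map_layerOut (a a' : Fin n → ℝ) (k : Fin m) :
    (layerLaw n m).map (fun g => (!₂[layerOut β g a k, layerOut β g a' k] :
      EuclideanSpace ℝ (Fin 2))) =
    pairLaw (layerCov β a a) (layerCov β a a') (layerCov β a' a') := by
  simp only [layerOut_eq_sum, layerLaw, map_pi_gaussianReal, sum_layerCoeff_mul]

theorem measurePreserving_layerOut (a : Fin n → ℝ) (k : Fin m) :
    MeasurePreserving (fun g => layerOut β g a k) (layerLaw n m)
      (gaussianReal 0 (layerCov β a a).toNNReal) := by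
  have h0 : 0 ≤ layerCov β a a := (sq_nonneg β).trans (sq_le_layerCov_self a)
  have h := (measurePreserving_fst_pairLaw h0 h0 (layerCovData_mem (β := β) a a).2.2)
  simp only [layerCovData] at h
  rw [← map_layerOut a a k] at h
  refine ⟨measurable_layerOut a k, ?_⟩
  rw [← h.map_eq, Measure.map_map h.measurable]
  · rfl
  · have := measurable_layerOut (m := m) (β := β) a k
    fun_prop

/-- Output `k` reads only column `k` of the weights and the bias `k`, so distinct outputs use
disjoint sets of independent parameters. -/
theorem indepFun_layerOut {ψ : ℝ → ℝ → ℝ} (hψ : Measurable (Function.uncurry ψ))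
    (a a' : Fin n → ℝ) {k k' : Fin m} (hk : k ≠ k') :
    IndepFun (fun g => ψ (layerOut β g a k) (layerOut β g a' k))
      (fun g => ψ (layerOut β g a k') (layerOut β g a' k')) (layerLaw n m) := by
  classical
  let col : (Fin n × Fin m) ⊕ Fin m → Fin m := Sum.elim Prod.snd id
  have hm : ∀ k : Fin m, Measurable fun g => ψ (layerOut β g a k) (layerOut β g a' k) := fun k =>
    hψ.comp ((measurable_layerOut a k).prodMk (measurable_layerOut a' k))
  have hd : ∀ (a : Fin n → ℝ) (k : Fin m) (g g' : (Fin n × Fin m) ⊕ Fin m → ℝ),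
      (∀ q ∈ Finset.univ.filter (fun q => col q = k), g q = g' q) →
      layerOut β g a k = layerOut β g' a k := by
    intro a k g g' h
    simp only [layerOut, layer]
    rw [h (.inr k) (by simp [col])]
    congr 2
    exact Finset.sum_congr rfl fun i _ => by rw [h (.inl (i, k)) (by simp [col])]
  refine indepFun_pi_of_disjoint _ (S := Finset.univ.filter fun q => col q = k)
    (T := Finset.univ.filter fun q => col q = k') ?_ (hm k) (hm k') ?_ ?_
  · rw [Finset.disjoint_filter]
    rintro q - rfl
    exact hk
  · intro g g' h; simp only [hd _ _ g g' h]
  · intro g g' h; simp only [hd _ _ g g' h]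

/-- The law of large numbers, with an explicit rate, for the outputs of a layer. -/
theorem layerLaw_average_sub_ge_le (hβ : 0 < β) {ψ : ℝ → ℝ → ℝ} {K : ℝ}
    (hψ : Measurable (Function.uncurry ψ)) (hK : ∀ u v, |ψ u v| ≤ K * (1 + u ^ 2 + v ^ 2))
    (hm : 0 < m) (a a' : Fin n → ℝ) {ε : ℝ} (hε : 0 < ε) :
    layerLaw n m {g | ε ≤ |1 / (m : ℝ) * ∑ k, ψ (layerOut β g a k) (layerOut β g a' k) -
      pairExp ψ (layerCovData β a a')|} ≤
    ENNReal.ofReal (sqBound K (layerCovData β a a') / (m * ε ^ 2)) := by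
  have hb : 0 < β ^ 2 := by positivity
  have hp := layerCovData_mem (β := β) a a'
  have hmO : ∀ k : Fin m, Measurable fun g => (!₂[layerOut β g a k, layerOut β g a' k] :
      EuclideanSpace ℝ (Fin 2)) := fun k => by
    have h1 := measurable_layerOut (β := β) a k
    have h2 := measurable_layerOut (β := β) a' k
    fun_prop
  have hint : ∀ {φ : ℝ → ℝ → ℝ}, Measurable (Function.uncurry φ) → ∀ k : Fin m,
      ∫ g, φ (layerOut β g a k) (layerOut β g a' k) ∂layerLaw n m =
        pairExp φ (layerCovData β a a') := by
    intro φ hφ k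
    rw [pairExp, layerCovData, ← map_layerOut a a' k, integral_map (hmO k).aemeasurable
      (measurable_comp_pair hφ).aestronglyMeasurable]
    simp
  refine measure_average_sub_ge_le hm (fun k => ?_)
    (fun k k' hk => indepFun_layerOut hψ a a' hk) (hint hψ) (fun k => ?_) hε
  · have := memLp_of_growth hb hp hψ hK
    simp only [layerCovData] at this
    rw [← map_layerOut a a' k] at this
    exact this.comp_of_map (hmO k).aemeasurable
  · have h2 : Measurable (Function.uncurry fun u v => ψ u v ^ 2) := hψ.pow_const 2
    rw [hint h2 k]
    exact integral_sq_le_sqBound hb hp hψ hK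

theorem measurePreserving_layerLaw (q : (Fin n × Fin m) ⊕ Fin m) :
    MeasurePreserving (fun g => g q) (layerLaw n m) (gaussianReal 0 1) :=
  measurePreserving_eval _ q

theorem integral_weight_mul (i : Fin n) (k k' : Fin m) :
    ∫ g, g (.inl (i, k)) * g (.inl (i, k')) ∂layerLaw n m = if k = k' then 1 else 0 := by
  have hid : ∀ q, ∫ g, g q ∂layerLaw n m = 0 := fun q => by
    have h := integral_id_gaussianReal (μ := 0) (v := 1)
    rwa [← (measurePreserving_layerLaw q).map_eq,
      integral_map (measurable_pi_apply q).aemeasurable (by fun_prop)] at h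
  split_ifs with h
  · subst h
    have h := variance_fun_id_gaussianReal (μ := 0) (v := 1)
    rw [variance_eq_integral (by fun_prop)] at h
    simp only [integral_id_gaussianReal, sub_zero, pow_two] at h
    rw [← (measurePreserving_layerLaw (.inl (i, k))).map_eq,
      integral_map (measurable_pi_apply _).aemeasurable (by fun_prop)] at h
    simpa using h
  · have hind : IndepFun (fun g : (Fin n × Fin m) ⊕ Fin m → ℝ => g (.inl (i, k)))
        (fun g => g (.inl (i, k'))) (layerLaw n m) :=
      (iIndepFun_pi (X := fun _ x => x) fun i => aemeasurable_id).indepFun (by simpa using h)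
    rw [hind.integral_fun_mul_eq_mul_integral (measurable_pi_apply _).aestronglyMeasurable
      (measurable_pi_apply _).aestronglyMeasurable, hid, zero_mul]

/-- The law of large numbers, with an explicit rate, for products of outgoing weights. -/
theorem layerLaw_weight_average_ge_le (hn : 0 < n) (k k' : Fin m) {t : Fin n → ℝ} {T : ℝ}
    (ht : ∀ i, |t i| ≤ T) {ε : ℝ} (hε : 0 < ε) :
    layerLaw n m {g | ε ≤ |1 / (n : ℝ) * ∑ i,
      (g (.inl (i, k)) * g (.inl (i, k')) - if k = k' then 1 else 0) * t i|} ≤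
    ENNReal.ofReal (T ^ 2 * (2 * fourthMoment + 2) / (n * ε ^ 2)) := by
  classical
  set d : ℝ := if k = k' then 1 else 0
  have hd : d ^ 2 ≤ 1 := by simp only [d]; split_ifs <;> norm_num
  have h4 : ∀ q, Integrable (fun g : (Fin n × Fin m) ⊕ Fin m → ℝ => g q ^ 4) (layerLaw n m) :=
    fun q => (measurePreserving_layerLaw q).integrable_comp_of_integrable
      (integrable_pow_gaussianReal 1 4)
  have h4e : ∀ q, ∫ g, g q ^ 4 ∂layerLaw n m = fourthMoment := fun q => by
    rw [fourthMoment, ← (measurePreserving_layerLaw q).map_eq,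
      integral_map (measurable_pi_apply q).aemeasurable (by fun_prop)]
  -- From `(u v - d) ^ 2 ≤ 2 u ^ 2 v ^ 2 + 2 d ^ 2 ≤ u ^ 4 + v ^ 4 + 2`. This covers `k = k'` and `k
  -- ≠ k'` together, and integrates to the constant `2 * fourthMoment + 2`.
  have hbd : ∀ i (g : (Fin n × Fin m) ⊕ Fin m → ℝ),
      ((g (.inl (i, k)) * g (.inl (i, k')) - d) * t i) ^ 2 ≤
        T ^ 2 * (g (.inl (i, k)) ^ 4 + g (.inl (i, k')) ^ 4 + 2) := by
    intro i g
    have ht2 : t i ^ 2 ≤ T ^ 2 := by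
      rw [← sq_abs]; exact pow_le_pow_left₀ (abs_nonneg _) (ht i) 2
    rw [mul_pow, mul_comm (T ^ 2)]
    gcongr
    set u := g (.inl (i, k))
    set v := g (.inl (i, k'))
    nlinarith [sq_nonneg (u ^ 2 - v ^ 2), sq_nonneg (u * v + d)]
  have hbi : ∀ i, Integrable (fun g : (Fin n × Fin m) ⊕ Fin m → ℝ =>
      T ^ 2 * (g (.inl (i, k)) ^ 4 + g (.inl (i, k')) ^ 4 + 2)) (layerLaw n m) := fun i =>
    (((h4 _).add (h4 _)).add (integrable_const _)).const_mul _
  have hsq : ∀ i, Integrable (fun g : (Fin n × Fin m) ⊕ Fin m → ℝ =>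
      ((g (.inl (i, k)) * g (.inl (i, k')) - d) * t i) ^ 2) (layerLaw n m) := fun i =>
    (hbi i).mono' (by fun_prop) (ae_of_all _ fun g => by
      rw [Real.norm_eq_abs, abs_of_nonneg (sq_nonneg _)]; exact hbd i g)
  have hL : ∀ i, MemLp (fun g : (Fin n × Fin m) ⊕ Fin m → ℝ =>
      (g (.inl (i, k)) * g (.inl (i, k')) - d) * t i) 2 (layerLaw n m) := fun i =>
    (memLp_two_iff_integrable_sq (by fun_prop)).2 (hsq i)
  have hprod : ∀ i, Integrable (fun g : (Fin n × Fin m) ⊕ Fin m → ℝ =>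
      g (.inl (i, k)) * g (.inl (i, k'))) (layerLaw n m) := fun i => by
    have h2 : ∀ q, Integrable (fun g : (Fin n × Fin m) ⊕ Fin m → ℝ => g q ^ 2) (layerLaw n m) :=
      fun q => (measurePreserving_layerLaw q).integrable_comp_of_integrable
        (integrable_pow_gaussianReal 1 2)
    refine ((h2 (.inl (i, k))).add (h2 (.inl (i, k')))).mono' (by fun_prop)
      (ae_of_all _ fun g => ?_)
    simp only [Real.norm_eq_abs, Pi.add_apply]
    rw [abs_le]
    constructor <;> nlinarith [sq_nonneg (g (.inl (i, k)) - g (.inl (i, k'))),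
      sq_nonneg (g (.inl (i, k)) + g (.inl (i, k')))]
  have := measure_average_sub_ge_le hn hL (e := 0) (V := T ^ 2 * (2 * fourthMoment + 2))
    (fun i j hij => ?_) (fun i => ?_) (fun i => ?_) hε
  · simpa using this
  · refine indepFun_pi_of_disjoint _ (S := {.inl (i, k), .inl (i, k')})
      (T := {.inl (j, k), .inl (j, k')}) ?_ (by fun_prop) (by fun_prop) ?_ ?_
    · simp [Finset.disjoint_left, hij]
    · intro g g' h
      simp only [h (.inl (i, k)) (by simp), h (.inl (i, k')) (by simp)]
    · intro g g' h
      simp only [h (.inl (j, k)) (by simp), h (.inl (j, k')) (by simp)]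
  · rw [integral_mul_const, integral_sub (hprod i) (integrable_const _), integral_weight_mul]
    simp [d]
  · refine (integral_mono (hsq i) (hbi i) (hbd i)).trans_eq ?_
    rw [integral_const_mul, integral_add (f := fun g : (Fin n × Fin m) ⊕ Fin m → ℝ =>
      g (.inl (i, k)) ^ 4 + g (.inl (i, k')) ^ 4) ((h4 _).add (h4 _)) (integrable_const _),
      integral_add (h4 _) (h4 _), h4e, h4e]
    rw [integral_const, probReal_univ, one_smul, two_mul]

end Layer

/-! ### Splitting the parameters into the subnetwork and the last layer -/

section Split

theorem measurePreserving_comp_equiv {ι κ : Type*} [Fintype ι] [Fintype κ] (e : ι ≃ κ) :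
    MeasurePreserving (fun (θ : κ → ℝ) (i : ι) => θ (e i))
      (Measure.pi fun _ : κ => gaussianReal 0 1) (Measure.pi fun _ : ι => gaussianReal 0 1) :=
  (measurePreserving_piCongrLeft (fun _ : κ => gaussianReal 0 1) e).symm

variable {n₀ m w : ℕ} {ws : List ℕ}

instance isProbabilityMeasure_initLaw (hs : List ℕ) : IsProbabilityMeasure (initLaw n₀ hs m) := by
  unfold initLaw; infer_instance

/-- The parameters of a network without hidden layer, as those of a layer. -/
def splitNil (θ : ParamIdx n₀ [] m → ℝ) : (Fin n₀ × Fin m) ⊕ Fin m → ℝ :=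
  fun q => θ (ParamIdx.nilEquiv n₀ m q)

/-- The parameters of the subnetwork computing the last hidden layer. -/
def prevParam (θ : ParamIdx n₀ (w :: ws) m → ℝ) : ParamIdx n₀ ws w → ℝ :=
  fun p => θ (.prev p)

/-- The parameters of the last layer. -/
def lastParam (θ : ParamIdx n₀ (w :: ws) m → ℝ) : (Fin w × Fin m) ⊕ Fin m → ℝ :=
  fun q => θ (ParamIdx.consEquiv n₀ w ws m (.inr q))

theorem measurePreserving_splitNil :
    MeasurePreserving (splitNil (n₀ := n₀) (m := m)) (initLaw n₀ [] m) (layerLaw n₀ m) :=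
  measurePreserving_comp_equiv _

/-- The last layer is independent of the subnetwork below it. Conditioning on the subnetwork
therefore becomes Fubini on this product. -/
theorem measurePreserving_splitCons :
    MeasurePreserving (fun θ : ParamIdx n₀ (w :: ws) m → ℝ => (prevParam θ, lastParam θ))
      (initLaw n₀ (w :: ws) m) ((initLaw n₀ ws w).prod (layerLaw w m)) :=
  (measurePreserving_sumPiEquivProdPi fun _ : ParamIdx n₀ ws w ⊕ ((Fin w × Fin m) ⊕ Fin m) =>
    gaussianReal 0 1).comp (measurePreserving_comp_equiv (ParamIdx.consEquiv n₀ w ws m))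

theorem network_nil (σ : ℝ → ℝ) (β : ℝ) (θ : ParamIdx n₀ [] m → ℝ) (x : Fin n₀ → ℝ) (k : Fin m) :
    network σ β [] θ x k = layerOut β (splitNil θ) x k := rfl

theorem network_cons (σ : ℝ → ℝ) (β : ℝ) (θ : ParamIdx n₀ (w :: ws) m → ℝ) (x : Fin n₀ → ℝ)
    (k : Fin m) :
    network σ β (w :: ws) θ x k =
      layerOut β (lastParam θ) (fun i => σ (network σ β ws (prevParam θ) x i)) k := rfl

theorem continuous_network {σ : ℝ → ℝ} (hσ : Continuous σ) (β : ℝ) (x : Fin n₀ → ℝ) :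
    ∀ (hs : List ℕ) {m : ℕ} (k : Fin m), Continuous fun θ => network σ β hs θ x k
  | [], m, k => by
    simp only [network, layer]
    fun_prop
  | w :: ws, m, k => by
    have ih := fun i : Fin w => continuous_network hσ β x ws i
    have ih' : ∀ i : Fin w, Continuous fun θ : ParamIdx n₀ (w :: ws) m → ℝ =>
        σ (network σ β ws (fun p => θ (.prev p)) x i) := fun i =>
      hσ.comp ((ih i).comp (by fun_prop))
    simp only [network, layer]
    fun_prop

end Split

/-! ### Symmetries of Gaussian pair expectations -/

section PairIdentities

variable {b : ℝ} {p : ℝ × ℝ × ℝ} {ψ : ℝ → ℝ → ℝ}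

/-- Realizes the pair as two linear forms in the same Gaussian vector. Exchanging the forms, or
using one of them twice, then yields the identities below. -/
theorem exists_gram (hb : 0 < b) (hp : p ∈ covSet b) : ∃ A B : Fin 2 → ℝ,
    ∑ i, A i * A i = p.1 ∧ ∑ i, A i * B i = p.2.1 ∧ ∑ i, B i * B i = p.2.2 := by
  have hs : 0 < p.1 := hb.trans_le hp.1
  have h0 : 0 ≤ p.2.2 - p.2.1 ^ 2 / p.1 := by
    rw [sub_nonneg, div_le_iff₀ hs]; linarith [hp.2.2]
  have hne : √p.1 ≠ 0 := (Real.sqrt_pos.2 hs).ne'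
  refine ⟨![√p.1, 0], ![p.2.1 / √p.1, √(p.2.2 - p.2.1 ^ 2 / p.1)], ?_, ?_, ?_⟩
  · simp [Fin.sum_univ_two, Real.mul_self_sqrt hs.le]
  · simp only [Fin.sum_univ_two, Matrix.cons_val_zero, Matrix.cons_val_one, zero_mul, add_zero]
    field_simp
  · simp only [Fin.sum_univ_two, Matrix.cons_val_zero, Matrix.cons_val_one,
      Real.mul_self_sqrt h0, div_mul_div_comm, Real.mul_self_sqrt hs.le]
    ring

theorem pairExp_swap (hb : 0 < b) (hp : p ∈ covSet b) (hψ : Measurable (Function.uncurry ψ)) :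
    pairExp ψ (p.2.2, p.2.1, p.1) = pairExp (fun u v => ψ v u) p := by
  obtain ⟨A, B, h1, h2, h3⟩ := exists_gram hb hp
  simp only [pairExp, ← h1, ← h2, ← h3]
  rw [← integral_pi_gaussianReal A B (ψ := fun u v => ψ v u) (hψ.comp measurable_swap),
    ← Finset.sum_congr rfl fun i _ => mul_comm (B i) (A i), ← integral_pi_gaussianReal B A hψ]

theorem pairExp_diag_fst (hb : 0 < b) (hp : p ∈ covSet b)
    (hψ : Measurable (Function.uncurry ψ)) :
    pairExp ψ (p.1, p.1, p.1) = pairExp (fun u _ => ψ u u) p := by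
  obtain ⟨A, B, h1, h2, h3⟩ := exists_gram hb hp
  simp only [pairExp, ← h1, ← h2, ← h3]
  rw [← integral_pi_gaussianReal A B (ψ := fun u _ => ψ u u)
    (hψ.comp (measurable_fst.prodMk measurable_fst)), ← integral_pi_gaussianReal A A hψ]

theorem pairExp_diag_snd (hb : 0 < b) (hp : p ∈ covSet b)
    (hψ : Measurable (Function.uncurry ψ)) :
    pairExp ψ (p.2.2, p.2.2, p.2.2) = pairExp (fun _ v => ψ v v) p := by
  obtain ⟨A, B, h1, h2, h3⟩ := exists_gram hb hp
  simp only [pairExp, ← h1, ← h2, ← h3]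
  rw [← integral_pi_gaussianReal A B (ψ := fun _ v => ψ v v)
    (hψ.comp (measurable_snd.prodMk measurable_snd)), ← integral_pi_gaussianReal B B hψ]

end PairIdentities

/-! ### The limiting covariance kernels -/

section Kernels

variable {σ : ℝ → ℝ} {c : NNReal} {β : ℝ} {n₀ : ℕ}

theorem abs_mul_le_of_lipschitz (hσ : LipschitzWith c σ) (u v : ℝ) :
    |σ u * σ v| ≤ 2 * (|σ 0| + c) ^ 2 * (1 + u ^ 2 + v ^ 2) := by
  have h : ∀ u, |σ u| ≤ (|σ 0| + c) * (1 + |u|) := fun u => by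
    have h1 := hσ.dist_le_mul u 0
    rw [Real.dist_eq, Real.dist_eq, sub_zero] at h1
    have h2 : |σ u| ≤ |σ 0| + |σ u - σ 0| := by
      simpa using abs_add_le (σ 0) (σ u - σ 0)
    have h3 : 0 ≤ |σ 0| * |u| := by positivity
    have h4 : (0 : ℝ) ≤ c := c.2
    nlinarith
  rw [abs_mul]
  calc |σ u| * |σ v| ≤ ((|σ 0| + c) * (1 + |u|)) * ((|σ 0| + c) * (1 + |v|)) :=
        mul_le_mul (h u) (h v) (abs_nonneg _) ((abs_nonneg _).trans (h u))
    _ = (|σ 0| + c) ^ 2 * ((1 + |u|) * (1 + |v|)) := by ring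
    _ ≤ (|σ 0| + c) ^ 2 * (2 * (1 + u ^ 2 + v ^ 2)) := by
        refine mul_le_mul_of_nonneg_left ?_ (sq_nonneg _)
        rw [← sq_abs u, ← sq_abs v]
        nlinarith [sq_nonneg (|u| - 1), sq_nonneg (|v| - 1), sq_nonneg (|u| - |v|)]
    _ = _ := by ring

theorem measurable_uncurry_mul {φ : ℝ → ℝ} (hφ : Measurable φ) :
    Measurable (Function.uncurry fun u v => φ u * φ v) :=
  (hφ.comp measurable_fst).mul (hφ.comp measurable_snd)

/-- The covariance data of the limiting Gaussian process at two inputs. -/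
noncomputable def sigData (σ : ℝ → ℝ) (β : ℝ) (H : ℕ) (x x' : Fin n₀ → ℝ) : ℝ × ℝ × ℝ :=
  (Sig σ β H x x, Sig σ β H x x', Sig σ β H x' x')

/-- The covariance data obtained from a Gaussian pair by applying a Lipschitz nonlinearity. -/
theorem pairExp_mem_covSet (hσ : LipschitzWith c σ) {b : ℝ} (hb : 0 < b) {p : ℝ × ℝ × ℝ}
    (hp : p ∈ covSet b) {d : ℝ} (hd : 0 ≤ d) :
    (pairExp (fun u _ => σ u * σ u) p + d, pairExp (fun u v => σ u * σ v) p + d,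
      pairExp (fun _ v => σ v * σ v) p + d) ∈ covSet d := by
  have hm := hσ.continuous.measurable
  set K := 4 * (|σ 0| + c) ^ 2
  have i1 : Integrable (fun v : EuclideanSpace ℝ (Fin 2) => σ (v 0) * σ (v 0))
      (pairLaw p.1 p.2.1 p.2.2) :=
    (memLp_of_growth hb hp (ψ := fun u _ => σ u * σ u) (K := K)
      ((hm.comp measurable_fst).mul (hm.comp measurable_fst))
      fun u v => (abs_mul_le_of_lipschitz hσ u u).trans (by
        simp only [K]
        nlinarith [mul_nonneg (sq_nonneg (|σ 0| + c)) (sq_nonneg v),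
          sq_nonneg (|σ 0| + c)])).integrable (by norm_num)
  have i2 : Integrable (fun v : EuclideanSpace ℝ (Fin 2) => σ (v 0) * σ (v 1))
      (pairLaw p.1 p.2.1 p.2.2) :=
    (memLp_of_growth hb hp (measurable_uncurry_mul hm)
      (abs_mul_le_of_lipschitz hσ)).integrable (by norm_num)
  have i3 : Integrable (fun v : EuclideanSpace ℝ (Fin 2) => σ (v 1) * σ (v 1))
      (pairLaw p.1 p.2.1 p.2.2) :=
    (memLp_of_growth hb hp (ψ := fun _ v => σ v * σ v) (K := K)
      ((hm.comp measurable_snd).mul (hm.comp measurable_snd))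
      fun u v => (abs_mul_le_of_lipschitz hσ v v).trans (by
        simp only [K]
        nlinarith [mul_nonneg (sq_nonneg (|σ 0| + c)) (sq_nonneg u),
          sq_nonneg (|σ 0| + c)])).integrable (by norm_num)
  set A := pairExp (fun u _ => σ u * σ u) p with hA
  set R := pairExp (fun u v => σ u * σ v) p with hR
  set B := pairExp (fun _ v => σ v * σ v) p with hB
  -- Cauchy–Schwarz through the discriminant: the quadratic is the expectation of `(t σ(f) + σ(f'))
  -- ^ 2`.
  have hquad : ∀ t : ℝ, 0 ≤ A * (t * t) + 2 * R * t + B := by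
    intro t
    have h : ∫ v, (t * t * (σ (v 0) * σ (v 0)) + (2 * t * (σ (v 0) * σ (v 1)) +
        σ (v 1) * σ (v 1))) ∂pairLaw p.1 p.2.1 p.2.2 = A * (t * t) + 2 * R * t + B := by
      have j2 : Integrable (fun v : EuclideanSpace ℝ (Fin 2) => 2 * t * (σ (v 0) * σ (v 1)) +
          σ (v 1) * σ (v 1)) (pairLaw p.1 p.2.1 p.2.2) := (i2.const_mul (2 * t)).add i3
      rw [integral_add (i1.const_mul (t * t)) j2, integral_add (i2.const_mul (2 * t)) i3,
        integral_const_mul, integral_const_mul, hA, hR, hB]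
      simp only [pairExp]
      ring
    rw [← h]
    refine integral_nonneg fun v => ?_
    have : t * t * (σ (v 0) * σ (v 0)) + (2 * t * (σ (v 0) * σ (v 1)) + σ (v 1) * σ (v 1)) =
      (t * σ (v 0) + σ (v 1)) ^ 2 := by ring
    simp only [Pi.zero_apply]
    rw [this]
    positivity
  have hA0 : 0 ≤ A := integral_nonneg fun v => mul_self_nonneg _
  have hB0 : 0 ≤ B := integral_nonneg fun v => mul_self_nonneg _
  have hdis := discrim_le_zero hquad
  -- The value at `-1` gives `2 R ≤ A + B`, which handles the cross terms created by adding `d` to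
  -- all three entries.
  have hm1 := hquad (-1)
  simp only [discrim] at hdis
  refine ⟨by simpa using hA0, by simpa using hB0, ?_⟩
  simp only
  nlinarith [mul_nonneg hd (by linarith : 0 ≤ A + B - 2 * R)]

theorem gaussExp_eq_pairExp {E : Type*} {S : E → E → ℝ} {x x' : E} (hS : S x' x = S x x')
    (φ : ℝ → ℝ) :
    gaussExp S φ x x' = pairExp (fun u v => φ u * φ v) (S x x, S x x', S x' x') := by
  rw [gaussExp, hS]; rfl

/-- `gaussExp` reads both off-diagonal entries of the covariance, while `pairLaw` has a single one,
so symmetry is needed to pass between them. Each inductive step uses both properties of the previous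
kernel. -/
theorem sig_symm_and_mem (hσ : LipschitzWith c σ) (hβ : 0 < β) (H : ℕ) :
    (∀ x x' : Fin n₀ → ℝ, Sig σ β H x' x = Sig σ β H x x') ∧
      ∀ x x' : Fin n₀ → ℝ, sigData σ β H x x' ∈ covSet (β ^ 2) := by
  have hb : 0 < β ^ 2 := by positivity
  induction H with
  | zero =>
    refine ⟨fun x x' => ?_, fun x x' => layerCovData_mem x x'⟩
    simp only [Sig, mul_comm]
  | succ H ih =>
    obtain ⟨hsymm, hmem⟩ := ih
    have hm := measurable_uncurry_mul hσ.continuous.measurable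
    have e2 : ∀ x x' : Fin n₀ → ℝ, Sig σ β (H + 1) x x' =
        pairExp (fun u v => σ u * σ v) (sigData σ β H x x') + β ^ 2 := fun x x' => by
      simp only [Sig]
      rw [gaussExp_eq_pairExp (hsymm x x')]
      rfl
    refine ⟨fun x x' => ?_, fun x x' => ?_⟩
    · rw [e2, e2]
      have := pairExp_swap hb (hmem x x') hm
      simp only [sigData] at this ⊢
      rw [hsymm x x', this]
      simp only [mul_comm]
    · have e1 := pairExp_diag_fst hb (hmem x x') hm
      have e3 := pairExp_diag_snd hb (hmem x x') hm
      rw [sigData, e2 x x, e2 x x', e2 x' x']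
      simp only [sigData] at e1 e3 ⊢
      rw [e1, e3]
      exact pairExp_mem_covSet hσ hb (hmem x x') hb.le

theorem sigData_mem (hσ : LipschitzWith c σ) (hβ : 0 < β) (H : ℕ) (x x' : Fin n₀ → ℝ) :
    sigData σ β H x x' ∈ covSet (β ^ 2) :=
  (sig_symm_and_mem hσ hβ H).2 x x'

theorem sig_succ (hσ : LipschitzWith c σ) (hβ : 0 < β) (H : ℕ) (x x' : Fin n₀ → ℝ) :
    Sig σ β (H + 1) x x' =
      pairExp (fun u v => σ u * σ v) (sigData σ β H x x') + β ^ 2 := by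
  simp only [Sig]
  rw [gaussExp_eq_pairExp ((sig_symm_and_mem hσ hβ H).1 x x')]
  rfl

theorem sigDot_eq (hσ : LipschitzWith c σ) (hβ : 0 < β) (H : ℕ) (x x' : Fin n₀ → ℝ) :
    SigDot σ β H x x' = pairExp (fun u v => deriv σ u * deriv σ v) (sigData σ β H x x') :=
  gaussExp_eq_pairExp ((sig_symm_and_mem hσ hβ H).1 x x') _

end Kernels

/-! ### The law of large numbers in the sequential limit -/

section LawOfLargeNumbers

/-- Observables of a pair of preactivations to which the law of large numbers applies. -/
structure Admissible (b : ℝ) (ψ : ℝ → ℝ → ℝ) : Prop where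
  measurable : Measurable (Function.uncurry ψ)
  growth : ∃ K, ∀ u v, |ψ u v| ≤ K * (1 + u ^ 2 + v ^ 2)
  continuousOn : ContinuousOn (pairExp ψ) (covSet b)

variable {σ : ℝ → ℝ} {c : NNReal} {β b : ℝ}

theorem admissible_of_lipschitz (hσ : LipschitzWith c σ) (hb : 0 < b) :
    Admissible b fun u v => σ u * σ v where
  measurable := measurable_uncurry_mul hσ.continuous.measurable
  growth := ⟨_, abs_mul_le_of_lipschitz hσ⟩
  continuousOn := continuousOn_pairExp hb
    ((hσ.continuous.comp continuous_fst).mul (hσ.continuous.comp continuous_snd))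
    (abs_mul_le_of_lipschitz hσ)

theorem abs_deriv_mul_le (hσ : LipschitzWith c σ) (u v : ℝ) :
    |deriv σ u * deriv σ v| ≤ c * c := by
  rw [abs_mul]
  exact mul_le_mul (abs_deriv_le hσ u) (abs_deriv_le hσ v) (abs_nonneg _) c.2

theorem admissible_deriv (hσ : LipschitzWith c σ) (hb : 0 < b) :
    Admissible b fun u v => deriv σ u * deriv σ v where
  measurable := measurable_uncurry_mul (measurable_deriv σ)
  growth := ⟨c * c, fun u v => (abs_deriv_mul_le hσ u v).trans (by
    have : (0 : ℝ) ≤ c * c := by positivity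
    nlinarith [mul_nonneg this (sq_nonneg u), mul_nonneg this (sq_nonneg v)])⟩
  continuousOn := continuousOn_pairExp_deriv hb hσ

/-- A bound for the probability of an event of a product space whose conditional probability is
small outside of an exceptional set. -/
theorem prod_le_add {α α' : Type*} [MeasurableSpace α] [MeasurableSpace α'] {μ : Measure α}
    {ν : Measure α'} [IsProbabilityMeasure μ] [IsProbabilityMeasure ν] {A : Set (α × α')}
    (hA : MeasurableSet A) (G : Set α) {η : ENNReal}
    (h : ∀ p ∉ G, ν (Prod.mk p ⁻¹' A) ≤ η) : μ.prod ν A ≤ μ G + η := by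
  rw [Measure.prod_apply hA]
  -- The exceptional set need not be measurable; its measurable hull has the same measure.
  calc ∫⁻ p, ν (Prod.mk p ⁻¹' A) ∂μ
      ≤ ∫⁻ p, (toMeasurable μ G).indicator 1 p + η ∂μ := by
        refine lintegral_mono fun p => ?_
        by_cases hp : p ∈ toMeasurable μ G
        · simp only [hp, Set.indicator_of_mem, Pi.one_apply]
          exact prob_le_one.trans le_self_add
        · simp only [hp, not_false_eq_true, Set.indicator_of_notMem, zero_add]
          exact h p fun hG => hp (subset_toMeasurable μ G hG)
    _ = μ G + η := by
        rw [lintegral_add_right _ measurable_const, lintegral_indicator_one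
          (measurableSet_toMeasurable μ G), measure_toMeasurable]
        simp

theorem eventually_ofReal_div_le (V : ℝ) {ε : ℝ} (hε : 0 < ε) {η : ENNReal} (hη : 0 < η) :
    ∀ᶠ w : ℕ in atTop, 0 < w ∧ ENNReal.ofReal (V / (w * ε ^ 2)) ≤ η := by
  have h : Tendsto (fun w : ℕ => ENNReal.ofReal (V / (w * ε ^ 2))) atTop (𝓝 0) := by
    have h1 : Tendsto (fun w : ℕ => (w : ℝ) * ε ^ 2) atTop atTop :=
      tendsto_natCast_atTop_atTop.atTop_mul_const (by positivity)
    simpa using ENNReal.tendsto_ofReal (h1.const_div_atTop V)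
  exact (eventually_gt_atTop 0).and (ENNReal.tendsto_nhds_zero.1 h η hη)

theorem eventually_seqAtTop_succ {H : ℕ} {p : List ℕ → Prop} :
    (∀ᶠ hs in seqAtTop (H + 1), p hs) ↔ ∀ᶠ w in atTop, ∀ᶠ ws in seqAtTop H, p (w :: ws) := by
  rw [seqAtTop, eventually_bind]
  rfl

/-- A single `δ` keeps both the Gaussian expectation and the Chebyshev constant under control. The
three coordinates appear separately because each is controlled by its own event. -/
theorem exists_delta (ψ : ℝ → ℝ → ℝ) (K : ℝ) (hψ : ContinuousOn (pairExp ψ) (covSet b))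
    {p₀ : ℝ × ℝ × ℝ} (hp₀ : p₀ ∈ covSet b) {ε : ℝ} (hε : 0 < ε) :
    ∃ δ > 0, ∀ p ∈ covSet b, |p.1 - p₀.1| < δ → |p.2.1 - p₀.2.1| < δ → |p.2.2 - p₀.2.2| < δ →
      |pairExp ψ p - pairExp ψ p₀| < ε ∧ sqBound K p ≤ sqBound K p₀ + 1 := by
  have h1 : ∀ᶠ p in 𝓝[covSet b] p₀, |pairExp ψ p - pairExp ψ p₀| < ε := by
    simpa [Real.dist_eq] using (hψ p₀ hp₀).eventually (Metric.ball_mem_nhds _ hε)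
  have h2 : ∀ᶠ p in 𝓝[covSet b] p₀, sqBound K p ≤ sqBound K p₀ + 1 :=
    nhdsWithin_le_nhds (((continuous_sqBound K).tendsto p₀).eventually_le_const (by linarith))
  obtain ⟨δ, hδ, h⟩ := Metric.mem_nhdsWithin_iff.1 (h1.and h2)
  refine ⟨δ, hδ, fun p hp e1 e2 e3 => h ⟨?_, hp⟩⟩
  rw [Metric.mem_ball, Prod.dist_eq, Prod.dist_eq, Real.dist_eq, Real.dist_eq, Real.dist_eq]
  exact max_lt e1 (max_lt e2 e3)

variable {n₀ : ℕ}

/-- The law of large numbers for the preactivations of the outputs of a wide network, in the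
sequential limit. -/
theorem network_average (hσ : LipschitzWith c σ) (hβ : 0 < β) (H : ℕ) (x x' : Fin n₀ → ℝ)
    {ψ : ℝ → ℝ → ℝ} (hψ : Admissible (β ^ 2) ψ) {ε : ℝ} (hε : 0 < ε) {η : ENNReal} (hη : 0 < η) :
    ∀ᶠ w : ℕ in atTop, ∀ᶠ ws in seqAtTop H, initLaw n₀ ws w
      {θ | ε ≤ |1 / (w : ℝ) * ∑ i, ψ (network σ β ws θ x i) (network σ β ws θ x' i) -
        pairExp ψ (sigData σ β H x x')|} ≤ η := by
  have hb : 0 < β ^ 2 := by positivity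
  induction H generalizing x x' ψ ε η with
  | zero =>
    obtain ⟨K, hK⟩ := hψ.growth
    filter_upwards [eventually_ofReal_div_le (sqBound K (layerCovData β x x')) hε hη]
      with w hw
    rw [seqAtTop, eventually_pure]
    refine le_trans ?_ ((layerLaw_average_sub_ge_le hβ hψ.measurable hK hw.1 x x' hε).trans hw.2)
    rw [← measurePreserving_splitNil.map_eq]
    exact Measure.le_map_apply measurePreserving_splitNil.aemeasurable _
  | succ H ih =>
    obtain ⟨K, hK⟩ := hψ.growth
    obtain ⟨δ, hδ, hδp⟩ := exists_delta ψ K hψ.continuousOn (sigData_mem hσ hβ (H + 1) x x')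
      (half_pos hε)
    -- The `+ 1` leaves room for the random covariance to differ from its limit. `V` depends only on
    -- the limit, so the threshold for `w` is independent of the earlier widths.
    set V := sqBound K (sigData σ β (H + 1) x x') + 1
    filter_upwards [eventually_ofReal_div_le V (half_pos hε) (ENNReal.half_pos hη.ne')] with w hw
    rw [eventually_seqAtTop_succ]
    -- Half of `η` pays for Chebyshev in the last layer; the other half is shared by the three
    -- empirical covariances at `(x, x)`, `(x, x')` and `(x', x')`.
    have hη6 : 0 < η / 2 / 3 := ENNReal.div_pos (ENNReal.half_pos hη.ne').ne' (by simp)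
    have hadm := admissible_of_lipschitz hσ hb
    filter_upwards [ih x x hadm hδ hη6, ih x x' hadm hδ hη6, ih x' x' hadm hδ hη6]
      with v h1 h2 h3
    filter_upwards [h1, h2, h3] with vs h1 h2 h3
    set G : (Fin n₀ → ℝ) → (Fin n₀ → ℝ) → Set (ParamIdx n₀ vs v → ℝ) := fun y y' =>
      {θ | δ ≤ |1 / (v : ℝ) * ∑ i, σ (network σ β vs θ y i) * σ (network σ β vs θ y' i) -
        pairExp (fun u v => σ u * σ v) (sigData σ β H y y')|} with hG
    let a : (ParamIdx n₀ vs v → ℝ) → (Fin n₀ → ℝ) → Fin v → ℝ :=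
      fun θ y i => σ (network σ β vs θ y i)
    have hclose : ∀ θ y y', θ ∉ G y y' →
        |layerCov β (a θ y) (a θ y') - Sig σ β (H + 1) y y'| < δ := by
      intro θ y y' h
      simp only [hG, Set.mem_ofPred_eq, not_le] at h
      rw [sig_succ hσ hβ, layerCov, add_sub_add_right_eq_sub]
      exact h
    let A : Set ((ParamIdx n₀ vs v → ℝ) × ((Fin v × Fin w) ⊕ Fin w → ℝ)) :=
      {q | ε ≤ |1 / (w : ℝ) * ∑ k, ψ (layerOut β q.2 (a q.1 x) k) (layerOut β q.2 (a q.1 x') k) -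
        pairExp ψ (sigData σ β (H + 1) x x')|}
    have hA : MeasurableSet A := by
      have hout : ∀ y (k : Fin w), Measurable fun q : (ParamIdx n₀ vs v → ℝ) ×
          ((Fin v × Fin w) ⊕ Fin w → ℝ) => layerOut β q.2 (a q.1 y) k := by
        intro y k
        refine measurable_layerOut_comp measurable_snd (measurable_pi_lambda _ fun i => ?_) k
        exact (hσ.continuous.measurable.comp
          (continuous_network hσ.continuous β y vs i).measurable).comp measurable_fst
      have hψo : ∀ k : Fin w, Measurable fun q : (ParamIdx n₀ vs v → ℝ) ×
          ((Fin v × Fin w) ⊕ Fin w → ℝ) =>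
          ψ (layerOut β q.2 (a q.1 x) k) (layerOut β q.2 (a q.1 x') k) := fun k =>
        hψ.measurable.comp ((hout x k).prodMk (hout x' k))
      exact measurableSet_le measurable_const
        (((Finset.measurable_fun_sum _ fun k _ => hψo k).const_mul _).sub_const _).abs
    have hpre : initLaw n₀ (v :: vs) w
        {θ | ε ≤ |1 / (w : ℝ) * ∑ i, ψ (network σ β (v :: vs) θ x i)
          (network σ β (v :: vs) θ x' i) - pairExp ψ (sigData σ β (H + 1) x x')|} =
        ((initLaw n₀ vs v).prod (layerLaw v w)) A := by
      rw [← measurePreserving_splitCons.map_eq, Measure.map_apply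
        measurePreserving_splitCons.measurable hA]
      rfl
    rw [hpre]
    refine (prod_le_add hA (G x x ∪ G x x' ∪ G x' x') (η := η / 2) fun θ hθ => ?_).trans ?_
    · simp only [Set.mem_union, not_or] at hθ
      obtain ⟨d1, d2⟩ := hδp (layerCovData β (a θ x) (a θ x')) (layerCovData_mem _ _)
        (hclose θ _ _ hθ.1.1) (hclose θ _ _ hθ.1.2) (hclose θ _ _ hθ.2)
      refine le_trans ?_ ((layerLaw_average_sub_ge_le hβ hψ.measurable hK hw.1 (a θ x) (a θ x')
        (half_pos hε)).trans (le_trans ?_ hw.2))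
      · refine measure_mono fun g hg => ?_
        simp only [A, Set.mem_preimage, Set.mem_ofPred_eq] at hg ⊢
        have := abs_sub_le (1 / (w : ℝ) * ∑ k, ψ (layerOut β g (a θ x) k)
          (layerOut β g (a θ x') k)) (pairExp ψ (layerCovData β (a θ x) (a θ x')))
          (pairExp ψ (sigData σ β (H + 1) x x'))
        linarith
      · apply ENNReal.ofReal_le_ofReal
        gcongr
    · calc initLaw n₀ vs v (G x x ∪ G x x' ∪ G x' x') + η / 2
          ≤ (η / 2 / 3 + η / 2 / 3 + η / 2 / 3) + η / 2 := by
            gcongr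
            exact (measure_union_le _ _).trans
              (add_le_add ((measure_union_le _ _).trans (add_le_add h1 h2)) h3)
        _ = η := by rw [ENNReal.add_thirds, ENNReal.add_halves]

end LawOfLargeNumbers

/-! ### Almost sure differentiability in the parameters -/

section Differentiability

variable {σ : ℝ → ℝ} {c : NNReal} {β : ℝ} {n₀ m w : ℕ} {ws : List ℕ}

/-- The outputs of a layer almost surely avoid every Lebesgue null set. -/
theorem ae_layerOut (hβ : 0 < β) {n : ℕ} {P : ℝ → Prop} (hP : ∀ᵐ u, P u) (a : Fin n → ℝ)
    (k : Fin m) : ∀ᵐ g ∂layerLaw n m, P (layerOut β g a k) := by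
  have hpos : 0 < layerCov β a a := (by positivity : 0 < β ^ 2).trans_le (sq_le_layerCov_self a)
  exact (measurePreserving_layerOut a k).quasiMeasurePreserving.ae
    ((gaussianReal_absolutelyContinuous 0 (by simpa using hpos)).ae_le hP)

theorem ae_initLaw_prevParam {P : (ParamIdx n₀ ws w → ℝ) → Prop}
    (h : ∀ᵐ θ ∂initLaw n₀ ws w, P θ) : ∀ᵐ θ ∂initLaw n₀ (w :: ws) m, P (prevParam θ) :=
  (Measure.quasiMeasurePreserving_fst.comp
    measurePreserving_splitCons.quasiMeasurePreserving).ae h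

/-- The outputs of a network are almost surely points of differentiability of the nonlinearity. -/
theorem ae_differentiableAt_activation (hσ : LipschitzWith c σ) (hβ : 0 < β) (hs : List ℕ)
    (x : Fin n₀ → ℝ) :
    ∀ᵐ θ ∂initLaw n₀ hs m, ∀ k, DifferentiableAt ℝ σ (network σ β hs θ x k) := by
  rw [ae_all_iff]
  intro k
  cases hs with
  | nil =>
    exact measurePreserving_splitNil.quasiMeasurePreserving.ae
      (ae_layerOut hβ (P := DifferentiableAt ℝ σ) hσ.ae_differentiableAt_real x k)
  | cons w ws =>
    have hm : MeasurableSet {q : (ParamIdx n₀ ws w → ℝ) × ((Fin w × Fin m) ⊕ Fin m → ℝ) |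
        DifferentiableAt ℝ σ (layerOut β q.2 (fun i => σ (network σ β ws q.1 x i)) k)} := by
      refine (measurable_layerOut_comp measurable_snd (measurable_pi_lambda _ fun i => ?_) k)
        (measurableSet_of_differentiableAt ℝ σ)
      exact (hσ.continuous.measurable.comp
        (continuous_network hσ.continuous β x ws i).measurable).comp measurable_fst
    -- By Fubini it is enough to fix the subnetwork, hence the input of the last layer, whose output
    -- is then a nondegenerate Gaussian.
    have h : ∀ᵐ q ∂(initLaw n₀ ws w).prod (layerLaw w m),
        DifferentiableAt ℝ σ (layerOut β q.2 (fun i => σ (network σ β ws q.1 x i)) k) := by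
      have hθ : ∀ a : Fin w → ℝ, ∀ᵐ g ∂layerLaw w m, DifferentiableAt ℝ σ (layerOut β g a k) :=
        fun a => ae_layerOut hβ (P := DifferentiableAt ℝ σ) hσ.ae_differentiableAt_real a k
      rw [Measure.ae_prod_iff_ae_ae hm]
      exact ae_of_all _ fun θ => hθ fun i => σ (network σ β ws θ x i)
    have h' := measurePreserving_splitCons.quasiMeasurePreserving.ae h
    simpa only [network_cons] using h'

/-- Induction by the chain rule: almost surely the subnetwork is differentiable and its outputs are
points of differentiability of `σ`. The last layer is polynomial in its parameters and inputs. -/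
theorem ae_differentiableAt_network (hσ : LipschitzWith c σ) (hβ : 0 < β) (x : Fin n₀ → ℝ) :
    ∀ (hs : List ℕ) {m : ℕ}, ∀ᵐ θ ∂initLaw n₀ hs m, ∀ k,
      DifferentiableAt ℝ (fun θ' => network σ β hs θ' x k) θ
  | [], m => by
    refine ae_of_all _ fun θ k => ?_
    simp only [network, layer]
    fun_prop
  | w :: ws, m => by
    filter_upwards [ae_initLaw_prevParam (m := m) (ae_differentiableAt_network hσ hβ x ws),
      ae_initLaw_prevParam (m := m) (ae_differentiableAt_activation hσ hβ ws x)] with θ h1 h2 k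
    have h3 : ∀ i : Fin w, DifferentiableAt ℝ (fun θ' : ParamIdx n₀ (w :: ws) m → ℝ =>
        σ (network σ β ws (fun p => θ' (.prev p)) x i)) θ := fun i =>
      (h2 i).comp θ ((h1 i).comp (f := fun θ' : ParamIdx n₀ (w :: ws) m → ℝ => prevParam θ') θ
        (by unfold prevParam; fun_prop))
    simp only [network, layer]
    fun_prop

end Differentiability

/-! ### The recursion for the tangent kernel -/

section Recursion

variable {σ : ℝ → ℝ} {β : ℝ} {n₀ n m w : ℕ} {ws : List ℕ}

theorem layerOut_add_smul (g h : (Fin n × Fin m) ⊕ Fin m → ℝ) (t : ℝ) (a : Fin n → ℝ)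
    (k : Fin m) : layerOut β (g + t • h) a k = layerOut β g a k + t * layerOut β h a k := by
  simp only [layerOut_eq_sum, Pi.add_apply, Pi.smul_apply, smul_eq_mul, Finset.mul_sum,
    ← Finset.sum_add_distrib]
  exact Finset.sum_congr rfl fun q _ => by ring

theorem layerOut_single [DecidableEq ((Fin n × Fin m) ⊕ Fin m)] (q : (Fin n × Fin m) ⊕ Fin m)
    (a : Fin n → ℝ) (k : Fin m) : layerOut β (Pi.single q 1) a k = layerCoeff β a k q := by
  simp [layerOut_eq_sum, Pi.single_apply]

/-- Distinct outputs share no parameter of the layer; this is the source of the factor `δ_kk'`. -/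
theorem sum_layerCoeff_mul_ite (a a' : Fin n → ℝ) (k k' : Fin m) :
    ∑ q, layerCoeff β a k q * layerCoeff β a' k' q = if k = k' then layerCov β a a' else 0 := by
  split_ifs with h
  · rw [h, sum_layerCoeff_mul]
  · refine Finset.sum_eq_zero fun q _ => ?_
    rcases q with ⟨i, j⟩ | j
    · simp only [layerCoeff, Sum.elim_inl]
      split_ifs with h1 h2
      · exact absurd (h1.symm.trans h2) h
      all_goals simp
    · simp only [layerCoeff, Sum.elim_inr]
      split_ifs with h1 h2
      · exact absurd (h1.symm.trans h2) h
      all_goals simp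

theorem partialNetwork_nil (θ : ParamIdx n₀ [] m → ℝ) (x : Fin n₀ → ℝ) (k : Fin m)
    (q : (Fin n₀ × Fin m) ⊕ Fin m) :
    partialNetwork σ β [] (ParamIdx.nilEquiv n₀ m q) θ x k = layerCoeff β x k q := by
  classical
  have hs : splitNil (Pi.single (ParamIdx.nilEquiv n₀ m q) 1) = Pi.single q 1 := by
    ext q'
    simp [splitNil, Pi.single_apply]
  have hd : HasLineDerivAt ℝ (fun θ' => network σ β [] θ' x k) (layerCoeff β x k q) θ
      (Pi.single (ParamIdx.nilEquiv n₀ m q) 1) := by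
    have : ∀ t : ℝ, network σ β [] (θ + t • Pi.single (ParamIdx.nilEquiv n₀ m q) 1) x k =
        layerOut β (splitNil θ) x k + t * layerCoeff β x k q := fun t => by
      rw [network_nil, ← layerOut_single, ← hs, ← layerOut_add_smul]
      rfl
    simp only [HasLineDerivAt, this]
    simpa using ((hasDerivAt_id (0 : ℝ)).mul_const (layerCoeff β x k q)).const_add
      (layerOut β (splitNil θ) x k)
  exact hd.lineDeriv

/-- The output is affine in the parameters of the last layer, so no differentiability of `σ` is
required. -/
theorem partialNetwork_last (θ : ParamIdx n₀ (w :: ws) m → ℝ) (x : Fin n₀ → ℝ) (k : Fin m)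
    (q : (Fin w × Fin m) ⊕ Fin m) :
    partialNetwork σ β (w :: ws) (ParamIdx.consEquiv n₀ w ws m (.inr q)) θ x k =
      layerCoeff β (fun i => σ (network σ β ws (prevParam θ) x i)) k q := by
  classical
  set p := ParamIdx.consEquiv n₀ w ws m (.inr q) with hp
  set a : Fin w → ℝ := fun i => σ (network σ β ws (prevParam θ) x i)
  have hs : lastParam (Pi.single p 1 : ParamIdx n₀ (w :: ws) m → ℝ) = Pi.single q 1 := by
    ext q'
    simp [lastParam, Pi.single_apply, hp]
  have hprev : ∀ t : ℝ, prevParam (θ + t • Pi.single p 1) = prevParam θ := fun t => by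
    ext r
    have : ParamIdx.prev r ≠ p := fun h => by
      have := (ParamIdx.consEquiv n₀ w ws m).injective
        (a₁ := .inl r) (a₂ := .inr q) (by rw [← hp, ← h]; rfl)
      simp at this
    simp [prevParam, this]
  have hd : HasLineDerivAt ℝ (fun θ' => network σ β (w :: ws) θ' x k) (layerCoeff β a k q) θ
      (Pi.single p 1) := by
    have : ∀ t : ℝ, network σ β (w :: ws) (θ + t • Pi.single p 1) x k =
        layerOut β (lastParam θ) a k + t * layerCoeff β a k q := fun t => by
      rw [network_cons, hprev, ← layerOut_single, ← hs, ← layerOut_add_smul]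
      rfl
    simp only [HasLineDerivAt, this]
    simpa using ((hasDerivAt_id (0 : ℝ)).mul_const (layerCoeff β a k q)).const_add
      (layerOut β (lastParam θ) a k)
  exact hd.lineDeriv

/-- Chain rule along one parameter of the subnetwork, the last layer staying fixed. The hypotheses
ensure that `deriv` and `lineDeriv` are genuine derivatives and not default zeros. -/
theorem partialNetwork_prev {θ : ParamIdx n₀ (w :: ws) m → ℝ} {x : Fin n₀ → ℝ}
    (h1 : ∀ i, DifferentiableAt ℝ (fun θ' => network σ β ws θ' x i) (prevParam θ))
    (h2 : ∀ i, DifferentiableAt ℝ σ (network σ β ws (prevParam θ) x i)) (k : Fin m)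
    (r : ParamIdx n₀ ws w) :
    partialNetwork σ β (w :: ws) (.prev r) θ x k =
      1 / √(w : ℝ) * ∑ i, lastParam θ (.inl (i, k)) *
        (deriv σ (network σ β ws (prevParam θ) x i) *
          partialNetwork σ β ws r (prevParam θ) x i) := by
  have hprev : ∀ t : ℝ, prevParam (θ + t • (Pi.single (.prev r) 1 :
      ParamIdx n₀ (w :: ws) m → ℝ)) = prevParam θ + t • Pi.single r 1 := fun t => by
    ext r'
    simp [prevParam, Pi.single_apply]
  have hlast : ∀ t : ℝ, lastParam (θ + t • (Pi.single (.prev r) 1 :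
      ParamIdx n₀ (w :: ws) m → ℝ)) = lastParam θ := fun t => by
    ext q
    have : ParamIdx.consEquiv n₀ w ws m (.inr q) ≠ .prev r := by
      rcases q with ⟨i, j⟩ | j <;> simp [ParamIdx.consEquiv]
    simp [lastParam, this]
  have hin : ∀ i, HasDerivAt (fun t : ℝ =>
      σ (network σ β ws (prevParam θ + t • Pi.single r 1) x i))
      (deriv σ (network σ β ws (prevParam θ) x i) *
        partialNetwork σ β ws r (prevParam θ) x i) 0 := by
    intro i
    have hl : HasDerivAt (fun t : ℝ => network σ β ws (prevParam θ + t • Pi.single r 1) x i)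
        (partialNetwork σ β ws r (prevParam θ) x i) 0 :=
      (h1 i).lineDifferentiableAt.hasLineDerivAt
    refine HasDerivAt.comp 0 (h₂ := σ) ?_ hl
    simpa using (h2 i).hasDerivAt
  have hd : HasLineDerivAt ℝ (fun θ' => network σ β (w :: ws) θ' x k)
      (1 / √(w : ℝ) * ∑ i, lastParam θ (.inl (i, k)) *
        (deriv σ (network σ β ws (prevParam θ) x i) *
          partialNetwork σ β ws r (prevParam θ) x i)) θ (Pi.single (.prev r) 1) := by
    simp only [HasLineDerivAt, network_cons, hprev, hlast, layerOut, layer]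
    exact ((HasDerivAt.fun_sum fun i _ => (hin i).const_mul _).const_mul _).add_const _
  exact hd.lineDeriv

theorem ntk_nil (θ : ParamIdx n₀ [] m → ℝ) (x x' : Fin n₀ → ℝ) (k k' : Fin m) :
    ntk σ β [] θ x x' k k' = if k = k' then layerCov β x x' else 0 := by
  rw [← sum_layerCoeff_mul_ite]
  simp only [ntk, Matrix.of_apply]
  rw [← (ParamIdx.nilEquiv n₀ m).sum_comp]
  simp only [partialNetwork_nil]

/-- The recursion for the neural tangent kernel. -/
theorem ntk_cons {θ : ParamIdx n₀ (w :: ws) m → ℝ} {x x' : Fin n₀ → ℝ}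
    (h1 : ∀ i, DifferentiableAt ℝ (fun θ' => network σ β ws θ' x i) (prevParam θ))
    (h2 : ∀ i, DifferentiableAt ℝ σ (network σ β ws (prevParam θ) x i))
    (h1' : ∀ i, DifferentiableAt ℝ (fun θ' => network σ β ws θ' x' i) (prevParam θ))
    (h2' : ∀ i, DifferentiableAt ℝ σ (network σ β ws (prevParam θ) x' i)) (k k' : Fin m) :
    ntk σ β (w :: ws) θ x x' k k' =
      1 / (w : ℝ) * ∑ i, ∑ j, lastParam θ (.inl (i, k)) * lastParam θ (.inl (j, k')) *
        (deriv σ (network σ β ws (prevParam θ) x i) *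
          deriv σ (network σ β ws (prevParam θ) x' j)) * ntk σ β ws (prevParam θ) x x' i j +
      if k = k' then layerCov β (fun i => σ (network σ β ws (prevParam θ) x i))
        (fun i => σ (network σ β ws (prevParam θ) x' i)) else 0 := by
  rw [← sum_layerCoeff_mul_ite]
  simp only [ntk, Matrix.of_apply]
  rw [← (ParamIdx.consEquiv n₀ w ws m).sum_comp, Fintype.sum_sum_type]
  congr 1
  · have hp : ∀ r : ParamIdx n₀ ws w, ParamIdx.consEquiv n₀ w ws m (.inl r) = .prev r :=
      fun r => rfl
    simp only [hp, partialNetwork_prev h1 h2, partialNetwork_prev h1' h2']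
    have hsq : 1 / √(w : ℝ) * (1 / √(w : ℝ)) = 1 / (w : ℝ) := by
      rw [div_mul_div_comm, one_mul, Real.mul_self_sqrt (Nat.cast_nonneg w)]
    have hmul : ∀ A B : ℝ, 1 / √(w : ℝ) * A * (1 / √(w : ℝ) * B) = 1 / (w : ℝ) * (A * B) :=
      fun A B => by rw [← hsq]; ring
    simp only [hmul]
    rw [← Finset.mul_sum]
    congr 1
    simp only [Finset.sum_mul_sum]
    rw [Finset.sum_comm]
    refine Finset.sum_congr rfl fun i _ => ?_
    rw [Finset.sum_comm]
    refine Finset.sum_congr rfl fun j _ => ?_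
    rw [Finset.mul_sum]
    exact Finset.sum_congr rfl fun r _ => by ring
  · simp only [partialNetwork_last]

end Recursion

/-! ### Convergence in probability of the entries -/

section Convergence

variable {σ : ℝ → ℝ} {c : NNReal} {β : ℝ} {n₀ m w : ℕ} {ws : List ℕ}

theorem tensorId_apply (K : (Fin n₀ → ℝ) → (Fin n₀ → ℝ) → ℝ) (x x' : Fin n₀ → ℝ) (k k' : Fin m) :
    tensorId K m x x' k k' = if k = k' then K x x' else 0 := by
  simp [tensorId, Matrix.one_apply]

/-- Continuity from above along events with empty intersection. It serves to bound the weights of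
the last layer once `w` is fixed. -/
theorem exists_measure_ge_le {α : Type*} [MeasurableSpace α] {ν : Measure α}
    [IsProbabilityMeasure ν] {Y : α → ℝ} (hY : Measurable Y) {η : ENNReal} (hη : 0 < η) :
    ∃ R > 0, ν {g | R ≤ Y g} ≤ η := by
  have hlim : Tendsto (fun n : ℕ => ν {g | ((n : ℝ) + 1) ≤ Y g}) atTop (𝓝 0) := by
    have h := tendsto_measure_iInter_atTop (μ := ν) (s := fun n : ℕ => {g | ((n : ℝ) + 1) ≤ Y g})
      (fun n => (measurableSet_le measurable_const hY).nullMeasurableSet)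
      (fun n n' hn g hg => by
        simp only [Set.mem_ofPred_eq] at hg ⊢
        have : (n : ℝ) ≤ n' := by exact_mod_cast hn
        linarith) ⟨0, measure_ne_top _ _⟩
    have he : ⋂ n : ℕ, {g | ((n : ℝ) + 1) ≤ Y g} = ∅ := by
      refine Set.eq_empty_of_forall_notMem fun g hg => ?_
      obtain ⟨n, hn⟩ := exists_nat_gt (Y g)
      have := Set.mem_iInter.1 hg n
      simp only [Set.mem_ofPred_eq] at this
      linarith
    rwa [he, measure_empty] at h
  obtain ⟨n, hn⟩ := (ENNReal.tendsto_nhds_zero.1 hlim η hη).exists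
  exact ⟨(n : ℝ) + 1, by positivity, hn⟩

/-- The inequality needs no measurability of `G` and is all that the union bounds require. -/
theorem initLaw_prevParam_le (G : Set (ParamIdx n₀ ws w → ℝ)) :
    initLaw n₀ (w :: ws) m (prevParam ⁻¹' G) ≤ initLaw n₀ ws w G := by
  have h := measurePreserving_fst.comp (measurePreserving_splitCons (n₀ := n₀) (m := m)
    (w := w) (ws := ws))
  conv_rhs => rw [← h.map_eq]
  exact Measure.le_map_apply h.aemeasurable G

theorem initLaw_lastParam_le (G : Set ((Fin w × Fin m) ⊕ Fin m → ℝ)) :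
    initLaw n₀ (w :: ws) m (lastParam ⁻¹' G) ≤ layerLaw w m G := by
  have h := measurePreserving_snd.comp (measurePreserving_splitCons (n₀ := n₀) (m := m)
    (w := w) (ws := ws))
  conv_rhs => rw [← h.map_eq]
  exact Measure.le_map_apply h.aemeasurable G

/-- Given the subnetwork, the derivative factors are constants bounded by `c * c`, and the weights
are independent of them. The bound is uniform in the earlier widths, with no exceptional set. -/
theorem initLaw_weight_average_ge_le (hσ : LipschitzWith c σ) (hw : 0 < w) (x x' : Fin n₀ → ℝ)
    (k k' : Fin m) {ρ : ℝ} (hρ : 0 < ρ) :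
    initLaw n₀ (w :: ws) m {θ | ρ ≤ |1 / (w : ℝ) * ∑ i,
      (lastParam θ (.inl (i, k)) * lastParam θ (.inl (i, k')) - if k = k' then 1 else 0) *
        (deriv σ (network σ β ws (prevParam θ) x i) *
          deriv σ (network σ β ws (prevParam θ) x' i))|} ≤
    ENNReal.ofReal (((c : ℝ) * c) ^ 2 * (2 * fourthMoment + 2) / (w * ρ ^ 2)) := by
  let A : Set ((ParamIdx n₀ ws w → ℝ) × ((Fin w × Fin m) ⊕ Fin m → ℝ)) :=
    {q | ρ ≤ |1 / (w : ℝ) * ∑ i,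
      (q.2 (.inl (i, k)) * q.2 (.inl (i, k')) - if k = k' then 1 else 0) *
        (deriv σ (network σ β ws q.1 x i) * deriv σ (network σ β ws q.1 x' i))|}
  have hA : MeasurableSet A := by
    have hd : ∀ y (i : Fin w), Measurable fun q : (ParamIdx n₀ ws w → ℝ) ×
        ((Fin w × Fin m) ⊕ Fin m → ℝ) => deriv σ (network σ β ws q.1 y i) := fun y i =>
      ((measurable_deriv σ).comp (continuous_network hσ.continuous β y ws i).measurable).comp
        measurable_fst
    refine measurableSet_le measurable_const
      ((Finset.measurable_fun_sum _ fun i _ => ?_).const_mul _).abs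
    exact Measurable.mul (by fun_prop) ((hd x i).mul (hd x' i))
  have hpre : initLaw n₀ (w :: ws) m {θ | ρ ≤ |1 / (w : ℝ) * ∑ i,
      (lastParam θ (.inl (i, k)) * lastParam θ (.inl (i, k')) - if k = k' then 1 else 0) *
        (deriv σ (network σ β ws (prevParam θ) x i) *
          deriv σ (network σ β ws (prevParam θ) x' i))|} =
      ((initLaw n₀ ws w).prod (layerLaw w m)) A := by
    rw [← measurePreserving_splitCons.map_eq, Measure.map_apply
      measurePreserving_splitCons.measurable hA]
    rfl
  rw [hpre]
  refine (prod_le_add hA ∅ fun θ _ => layerLaw_weight_average_ge_le hw k k'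
    (fun i => abs_deriv_mul_le hσ (network σ β ws θ x i) (network σ β ws θ x' i)) hρ).trans ?_
  simp

/-- The difference between the kernel of a network and the limiting kernel, in terms of the kernel
of the subnetwork computing the last hidden layer. -/
theorem ntk_sub_eq (A S D L d : ℝ) (u v : Fin w → ℝ) (t t' : Fin w → ℝ) (Θ : Fin w → Fin w → ℝ) :
    1 / (w : ℝ) * ∑ i, ∑ j, u i * v j * (t i * t' j) * Θ i j + d * A - d * (L * D + S) =
      1 / (w : ℝ) * ∑ i, ∑ j, u i * v j * (t i * t' j) * (Θ i j - if i = j then L else 0) +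
      L * (1 / (w : ℝ) * ∑ i, (u i * v i - d) * (t i * t' i)) +
      L * d * (1 / (w : ℝ) * ∑ i, t i * t' i - D) + d * (A - S) := by
  have h1 : ∑ i, ∑ j, u i * v j * (t i * t' j) * (Θ i j - if i = j then L else 0) =
      ∑ i, ∑ j, u i * v j * (t i * t' j) * Θ i j - L * ∑ i, u i * v i * (t i * t' i) := by
    simp only [mul_sub, Finset.sum_sub_distrib, mul_ite, mul_zero, Finset.sum_ite_eq,
      Finset.mem_univ, if_true, Finset.mul_sum]
    congr 1
    exact Finset.sum_congr rfl fun i _ => by ring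
  have h2 : ∑ i, (u i * v i - d) * (t i * t' i) =
      ∑ i, u i * v i * (t i * t' i) - d * ∑ i, t i * t' i := by
    simp only [sub_mul, Finset.sum_sub_distrib, Finset.mul_sum]
  rw [h1, h2]
  ring

/-- A crude bound without cancellation, the factor `1 / w` being discarded. It suffices because `w`
and `R` are fixed before `δ` is chosen. -/
theorem abs_kernel_error_lt (hw : 0 < w) {u v t t' : Fin w → ℝ} {E : Fin w → Fin w → ℝ}
    {C δ R e : ℝ} (hC : ∀ i j, |t i * t' j| ≤ C) (hE : ∀ i j, |E i j| ≤ δ) (hδ : 0 ≤ δ)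
    (hR : ∑ i, ∑ j, |u i| * |v j| ≤ R) (he : C * δ * R < e) :
    |1 / (w : ℝ) * ∑ i, ∑ j, u i * v j * (t i * t' j) * E i j| < e := by
  have hC0 : 0 ≤ C := (abs_nonneg _).trans (hC ⟨0, hw⟩ ⟨0, hw⟩)
  have h1 : |∑ i, ∑ j, u i * v j * (t i * t' j) * E i j| ≤ C * δ * R := by
    calc |∑ i, ∑ j, u i * v j * (t i * t' j) * E i j|
        ≤ ∑ i, ∑ j, |u i * v j * (t i * t' j) * E i j| :=
          (Finset.abs_sum_le_sum_abs _ _).trans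
            (Finset.sum_le_sum fun i _ => Finset.abs_sum_le_sum_abs _ _)
      _ ≤ ∑ i, ∑ j, |u i| * |v j| * (C * δ) := by
          refine Finset.sum_le_sum fun i _ => Finset.sum_le_sum fun j _ => ?_
          rw [abs_mul, abs_mul, abs_mul (u i), mul_assoc]
          gcongr
          · exact hC i j
          · exact hE i j
      _ = C * δ * ∑ i, ∑ j, |u i| * |v j| := by
          simp only [← Finset.sum_mul]; ring
      _ ≤ C * δ * R := by gcongr
  have h2 : 1 / (w : ℝ) ≤ 1 := by
    rw [div_le_one (by exact_mod_cast hw)]; exact_mod_cast hw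
  rw [abs_mul, abs_of_nonneg (by positivity : (0 : ℝ) ≤ 1 / w)]
  calc 1 / (w : ℝ) * _ ≤ 1 * (C * δ * R) := by gcongr
    _ < e := by rwa [one_mul]

/-- Convergence in probability of the entries of the neural tangent kernel. -/
theorem ntk_eventually (hσ : LipschitzWith c σ) (hβ : 0 < β) (H : ℕ) (x x' : Fin n₀ → ℝ) {m : ℕ}
    (k k' : Fin m) {ε : ℝ} (hε : 0 < ε) {η : ENNReal} (hη : 0 < η) :
    ∀ᶠ hs in seqAtTop H, initLaw n₀ hs m {θ | ε ≤ |ntk σ β hs θ x x' k k' -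
      tensorId (limitNTK σ β H) m x x' k k'|} ≤ η := by
  have hb : 0 < β ^ 2 := by positivity
  induction H generalizing m ε η with
  | zero =>
    rw [seqAtTop, eventually_pure]
    have : {θ | ε ≤ |ntk σ β [] θ x x' k k' -
        tensorId (limitNTK σ β 0) m x x' k k'|} = ∅ := by
      refine Set.eq_empty_of_forall_notMem fun θ hθ => ?_
      simp only [Set.mem_ofPred_eq, ntk_nil, tensorId_apply] at hθ
      have : limitNTK σ β 0 x x' = layerCov β x x' := rfl
      rw [this, sub_self, abs_zero] at hθ
      linarith
    rw [this, measure_empty]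
    exact zero_le
  | succ H ih =>
    rw [eventually_seqAtTop_succ]
    set L := limitNTK σ β H x x' with hL
    -- The error has four terms, each to be at most `ε / 4`. Three of them are at most `|L| ρ`, `|L|
    -- ρ` and `ρ`; `|L| + 1` serves for all.
    set ρ := ε / (4 * (|L| + 1)) with hρdef
    have hρ : 0 < ρ := by positivity
    have hρε : (|L| + 1) * ρ = ε / 4 := by rw [hρdef]; field_simp
    -- A quarter of `η` goes to each of the two laws of large numbers and to the weight average; the
    -- last quarter is halved between the subnetwork kernel and the size of the weights.
    have hη4 : 0 < η / 2 / 2 := ENNReal.half_pos (ENNReal.half_pos hη.ne').ne'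
    have hη8 : 0 < η / 2 / 2 / 2 := ENNReal.half_pos hη4.ne'
    filter_upwards [network_average hσ hβ H x x' (admissible_of_lipschitz hσ hb) hρ hη4,
      network_average hσ hβ H x x' (admissible_deriv hσ hb) hρ hη4,
      eventually_ofReal_div_le (((c : ℝ) * c) ^ 2 * (2 * fourthMoment + 2)) hρ hη4]
      with w hw1 hw4 hw3
    obtain ⟨R, hR, hRle⟩ := exists_measure_ge_le (ν := layerLaw w m)
      (Y := fun g => ∑ i, ∑ j, |g (.inl (i, k))| * |g (.inl (j, k'))|) (by fun_prop) hη8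
    -- The `+ 1` avoids division by zero when `c = 0` and makes `hδR` strict, the only strict one
    -- among the four bounds and enough for the contradiction.
    set δ := ε / (4 * ((c : ℝ) * c + 1) * R) with hδdef
    have hδ : 0 < δ := by positivity
    have hδR : (c : ℝ) * c * δ * R < ε / 4 := by
      have : ((c : ℝ) * c + 1) * δ * R = ε / 4 := by rw [hδdef]; field_simp
      nlinarith [mul_pos hδ hR]
    have hcard : 0 < η / 2 / 2 / 2 / (Fintype.card (Fin w × Fin w) : ENNReal) :=
      ENNReal.div_pos hη8.ne' (ENNReal.natCast_ne_top _)
    -- With `w` fixed, the subnetwork kernel has only `w ^ 2` entries, so the induction hypothesis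
    -- holds for all of them at once.
    have hIH : ∀ᶠ ws in seqAtTop H, ∀ q : Fin w × Fin w, initLaw n₀ ws w
        {θ | δ ≤ |ntk σ β ws θ x x' q.1 q.2 - tensorId (limitNTK σ β H) w x x' q.1 q.2|} ≤
          η / 2 / 2 / 2 / (Fintype.card (Fin w × Fin w) : ENNReal) :=
      eventually_all.2 fun q => ih q.1 q.2 hδ hcard
    filter_upwards [hw1, hw4, hIH] with ws hw1 hw4 hIH
    set G1 := {θ : ParamIdx n₀ ws w → ℝ | ρ ≤ |1 / (w : ℝ) * ∑ i,
      σ (network σ β ws θ x i) * σ (network σ β ws θ x' i) -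
        pairExp (fun u v => σ u * σ v) (sigData σ β H x x')|} with hG1
    set G4 := {θ : ParamIdx n₀ ws w → ℝ | ρ ≤ |1 / (w : ℝ) * ∑ i,
      deriv σ (network σ β ws θ x i) * deriv σ (network σ β ws θ x' i) -
        pairExp (fun u v => deriv σ u * deriv σ v) (sigData σ β H x x')|} with hG4
    set G3 := {θ : ParamIdx n₀ (w :: ws) m → ℝ | ρ ≤ |1 / (w : ℝ) * ∑ i,
      (lastParam θ (.inl (i, k)) * lastParam θ (.inl (i, k')) - if k = k' then 1 else 0) *
        (deriv σ (network σ β ws (prevParam θ) x i) *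
          deriv σ (network σ β ws (prevParam θ) x' i))|} with hG3
    set GE := ⋃ q : Fin w × Fin w, {θ : ParamIdx n₀ ws w → ℝ |
      δ ≤ |ntk σ β ws θ x x' q.1 q.2 - tensorId (limitNTK σ β H) w x x' q.1 q.2|} with hGE
    set GR := {g : (Fin w × Fin m) ⊕ Fin m → ℝ |
      R ≤ ∑ i, ∑ j, |g (.inl (i, k))| * |g (.inl (j, k'))|} with hGR
    have hdiff := fun y : Fin n₀ → ℝ => (ae_initLaw_prevParam (m := m) (w := w)
      (ae_differentiableAt_network hσ hβ y ws)).and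
      (ae_initLaw_prevParam (m := m) (ae_differentiableAt_activation hσ hβ ws y))
    have hae := (hdiff x).and (hdiff x')
    set Bad := {θ : ParamIdx n₀ (w :: ws) m → ℝ | ε ≤ |ntk σ β (w :: ws) θ x x' k k' -
      tensorId (limitNTK σ β (H + 1)) m x x' k k'|} with hBad
    set U : Set (ParamIdx n₀ (w :: ws) m → ℝ) := (prevParam ⁻¹' G1 ∪ prevParam ⁻¹' G4) ∪
      (G3 ∪ (prevParam ⁻¹' GE ∪ lastParam ⁻¹' GR)) with hU
    -- Off the exceptional set `U`, a bad parameter can only be one where the recursion fails for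
    -- lack of differentiability.
    have hnull : initLaw n₀ (w :: ws) m (Bad \ U) = 0 := by
      refine measure_mono_null ?_ (ae_iff.1 hae)
      rintro θ ⟨hθ, hnot⟩ hgood
      apply hnot
      by_contra hcon
      simp only [hU, Set.mem_union, Set.mem_preimage, not_or, hG1, hG3, hG4, hGR, hGE,
        Set.mem_iUnion, Set.mem_ofPred_eq, not_le, not_exists] at hcon
      obtain ⟨⟨e1, e4⟩, e3, eE, eR⟩ := hcon
      rw [hBad, Set.mem_ofPred_eq, ntk_cons hgood.1.1 hgood.1.2 hgood.2.1 hgood.2.2,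
        tensorId_apply] at hθ
      set d : ℝ := if k = k' then 1 else 0 with hd
      have hd1 : |d| ≤ 1 := by rw [hd]; split_ifs <;> simp
      have hite : ∀ y : ℝ, (if k = k' then y else 0) = d * y := fun y => by
        rw [hd]; split_ifs <;> simp
      have hlim : limitNTK σ β (H + 1) x x' = L * SigDot σ β H x x' + Sig σ β (H + 1) x x' := rfl
      rw [hite, hite, hlim, ntk_sub_eq _ _ _ _ _ (fun i => lastParam θ (.inl (i, k)))
        (fun j => lastParam θ (.inl (j, k')))
        (fun i => deriv σ (network σ β ws (prevParam θ) x i))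
        (fun j => deriv σ (network σ β ws (prevParam θ) x' j))
        (fun i j => ntk σ β ws (prevParam θ) x x' i j)] at hθ
      have e2 := abs_kernel_error_lt hw3.1
        (u := fun i => lastParam θ (.inl (i, k))) (v := fun j => lastParam θ (.inl (j, k')))
        (t := fun i => deriv σ (network σ β ws (prevParam θ) x i))
        (t' := fun j => deriv σ (network σ β ws (prevParam θ) x' j))
        (E := fun i j => ntk σ β ws (prevParam θ) x x' i j - if i = j then L else 0)
        (fun i j => abs_deriv_mul_le hσ _ _) (fun i j => by
          have := eE (i, j)
          rw [tensorId_apply] at this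
          exact this.le) hδ.le eR.le hδR
      have e1' : |layerCov β (fun i => σ (network σ β ws (prevParam θ) x i))
          (fun i => σ (network σ β ws (prevParam θ) x' i)) - Sig σ β (H + 1) x x'| < ρ := by
        rw [sig_succ hσ hβ, layerCov, add_sub_add_right_eq_sub]
        exact e1
      rw [← sigDot_eq hσ hβ] at e4
      have b3 := mul_le_mul_of_nonneg_left e3.le (abs_nonneg L)
      have b4 : |L * d * (1 / (w : ℝ) * ∑ i, deriv σ (network σ β ws (prevParam θ) x i) *
          deriv σ (network σ β ws (prevParam θ) x' i) - SigDot σ β H x x')| ≤ |L| * ρ := by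
        rw [abs_mul, abs_mul]
        calc |L| * |d| * _ ≤ |L| * 1 * ρ := by gcongr
          _ = |L| * ρ := by ring
      have b1 : |d * (layerCov β (fun i => σ (network σ β ws (prevParam θ) x i))
          (fun i => σ (network σ β ws (prevParam θ) x' i)) - Sig σ β (H + 1) x x')| ≤ 1 * ρ := by
        rw [abs_mul]
        gcongr
      rw [← abs_mul] at b3
      have hLρ : |L| * ρ ≤ ε / 4 := by linarith
      have h1ρ : 1 * ρ ≤ ε / 4 := by nlinarith [mul_nonneg (abs_nonneg L) hρ.le]
      have tri := hθ.trans ((abs_add_le _ _).trans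
        (add_le_add ((abs_add_le _ _).trans (add_le_add (abs_add_le _ _) le_rfl)) le_rfl))
      linarith
    refine (measure_mono (Set.subset_sdiff_union Bad U)).trans ((measure_union_le _ _).trans ?_)
    rw [hnull, zero_add]
    have hGEle : initLaw n₀ ws w GE ≤ η / 2 / 2 / 2 := by
      refine (measure_iUnion_fintype_le _ _).trans ?_
      refine (Finset.sum_le_sum fun q _ => hIH q).trans ?_
      rw [Finset.sum_const, Finset.card_univ, nsmul_eq_mul]
      exact ENNReal.mul_div_le
    calc _ ≤ (η / 2 / 2 + η / 2 / 2) + (η / 2 / 2 + (η / 2 / 2 / 2 + η / 2 / 2 / 2)) := by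
          refine (measure_union_le _ _).trans (add_le_add
            ((measure_union_le _ _).trans (add_le_add ?_ ?_))
            ((measure_union_le _ _).trans (add_le_add ?_
              ((measure_union_le _ _).trans (add_le_add ?_ ?_)))))
          · exact (initLaw_prevParam_le G1).trans hw1
          · exact (initLaw_prevParam_le G4).trans hw4
          · exact (initLaw_weight_average_ge_le hσ hw3.1 x x' k k' hρ).trans hw3.2
          · exact (initLaw_prevParam_le GE).trans hGEle
          · exact (initLaw_lastParam_le GR).trans hRle
      _ = η := by simp only [ENNReal.add_halves]

end Convergence

/-! ### From entries to the operator norm on a finite dataset -/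

section OperatorNorm

variable {n₀ m N : ℕ}

/-- A function of empirical norm at most `1` has squared coordinates at most `N` at the data points.
Each of the `N ^ 2` pairs then contributes at most `m ^ 2 * N * δ` to the form, which is divided by
`N ^ 2`. -/
theorem kernelOpNorm_le {X : Fin N → Fin n₀ → ℝ} {K : MatKernel n₀ m} {δ : ℝ}
    (hK : ∀ i j k k', |K (X i) (X j) k k'| ≤ δ) :
    kernelOpNorm X K ≤ √(δ * N * m ^ 2) := by
  refine Real.sSup_le ?_ (Real.sqrt_nonneg _)
  rintro r ⟨f, hf, rfl⟩
  apply Real.sqrt_le_sqrt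
  have hent : ∀ i k, f (X i) k * f (X i) k ≤ N := by
    intro i k
    have hN : (0 : ℝ) < N := by exact_mod_cast i.pos
    rw [inNormSq, one_div, inv_mul_le_iff₀ hN, mul_one] at hf
    have h1 : f (X i) k * f (X i) k ≤ f (X i) ⬝ᵥ f (X i) :=
      Finset.single_le_sum (f := fun k => f (X i) k * f (X i) k)
        (fun k _ => mul_self_nonneg _) (Finset.mem_univ k)
    have h2 : f (X i) ⬝ᵥ f (X i) ≤ ∑ i, f (X i) ⬝ᵥ f (X i) :=
      Finset.single_le_sum (f := fun i => f (X i) ⬝ᵥ f (X i))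
        (fun i _ => Finset.sum_nonneg fun k _ => mul_self_nonneg _) (Finset.mem_univ i)
    linarith
  have hterm : ∀ i j, |f (X i) ⬝ᵥ (K (X i) (X j)).mulVec (f (X j))| ≤ m ^ 2 * (N * δ) := by
    intro i j
    simp only [dotProduct, Matrix.mulVec, Finset.mul_sum]
    calc |∑ k, ∑ k', f (X i) k * (K (X i) (X j) k k' * f (X j) k')|
        ≤ ∑ k, ∑ k', |f (X i) k * (K (X i) (X j) k k' * f (X j) k')| :=
          (Finset.abs_sum_le_sum_abs _ _).trans
            (Finset.sum_le_sum fun k _ => Finset.abs_sum_le_sum_abs _ _)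
      _ ≤ ∑ _k : Fin m, ∑ _k' : Fin m, N * δ := by
          refine Finset.sum_le_sum fun k _ => Finset.sum_le_sum fun k' _ => ?_
          have h1 := hent i k
          have h2 := hent j k'
          have h3 : |f (X i) k * f (X j) k'| ≤ N := by
            rw [abs_le]
            constructor <;> nlinarith [sq_nonneg (f (X i) k - f (X j) k'),
              sq_nonneg (f (X i) k + f (X j) k')]
          calc |f (X i) k * (K (X i) (X j) k k' * f (X j) k')|
              = |f (X i) k * f (X j) k'| * |K (X i) (X j) k k'| := by
                rw [← abs_mul]; congr 1; ring
            _ ≤ N * δ := by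
                gcongr
                exact hK i j k k'
      _ = m ^ 2 * (N * δ) := by simp; ring
  rw [kernelForm, abs_mul, abs_of_nonneg (by positivity : (0 : ℝ) ≤ 1 / (N : ℝ) ^ 2)]
  rcases Nat.eq_zero_or_pos N with rfl | hN
  · simp
  · have hN' : (0 : ℝ) < N := by exact_mod_cast hN
    calc 1 / (N : ℝ) ^ 2 * |∑ i, ∑ j, f (X i) ⬝ᵥ (K (X i) (X j)).mulVec (f (X j))|
        ≤ 1 / (N : ℝ) ^ 2 * ∑ _i : Fin N, ∑ _j : Fin N, (m : ℝ) ^ 2 * (N * δ) := by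
          gcongr
          refine (Finset.abs_sum_le_sum_abs _ _).trans (Finset.sum_le_sum fun i _ => ?_)
          exact (Finset.abs_sum_le_sum_abs _ _).trans (Finset.sum_le_sum fun j _ => hterm i j)
      _ = δ * N * m ^ 2 := by
          simp only [Finset.sum_const, Finset.card_univ, Fintype.card_fin, nsmul_eq_mul]
          field_simp

theorem kernelOpNorm_eventually {σ : ℝ → ℝ} {c : NNReal} {β : ℝ} (hσ : LipschitzWith c σ)
    (hβ : 0 < β) (H : ℕ) (X : Fin N → Fin n₀ → ℝ) {ε : ℝ} (hε : 0 < ε) {η : ENNReal}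
    (hη : 0 < η) :
    ∀ᶠ hs in seqAtTop H, initLaw n₀ hs m {θ | ε ≤ kernelOpNorm X
      (ntk σ β hs θ - tensorId (limitNTK σ β H) m)} ≤ η := by
  -- Chosen so that `√(δ * N * m ^ 2) < ε`; the `+ 1` gives strictness and covers `N = 0` and `m =
  -- 0`.
  set δ := ε ^ 2 / ((N : ℝ) * m ^ 2 + 1) with hδdef
  have hδ : 0 < δ := by positivity
  have hδε : δ * N * m ^ 2 < ε ^ 2 := by
    have : δ * ((N : ℝ) * m ^ 2 + 1) = ε ^ 2 := by rw [hδdef]; field_simp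
    nlinarith
  let ι := (Fin N × Fin N) × (Fin m × Fin m)
  have hcard : 0 < η / (Fintype.card ι : ENNReal) :=
    ENNReal.div_pos hη.ne' (ENNReal.natCast_ne_top _)
  have hall : ∀ᶠ hs in seqAtTop H, ∀ q : ι, initLaw n₀ hs m
      {θ | δ ≤ |ntk σ β hs θ (X q.1.1) (X q.1.2) q.2.1 q.2.2 -
        tensorId (limitNTK σ β H) m (X q.1.1) (X q.1.2) q.2.1 q.2.2|} ≤
        η / (Fintype.card ι : ENNReal) :=
    eventually_all.2 fun q => ntk_eventually hσ hβ H _ _ q.2.1 q.2.2 hδ hcard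
  filter_upwards [hall] with hs hall
  have hsub : {θ | ε ≤ kernelOpNorm X (ntk σ β hs θ - tensorId (limitNTK σ β H) m)} ⊆
      ⋃ q : ι, {θ | δ ≤ |ntk σ β hs θ (X q.1.1) (X q.1.2) q.2.1 q.2.2 -
        tensorId (limitNTK σ β H) m (X q.1.1) (X q.1.2) q.2.1 q.2.2|} := by
    intro θ hθ
    by_contra hcon
    simp only [Set.mem_iUnion, Set.mem_ofPred_eq, not_le, not_exists] at hcon hθ
    have h := hθ.trans (kernelOpNorm_le fun i j k k' => (hcon ((i, j), (k, k'))).le)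
    rw [Real.le_sqrt hε.le (by positivity)] at h
    linarith
  refine (measure_mono hsub).trans ((measure_iUnion_fintype_le _ _).trans ?_)
  refine (Finset.sum_le_sum fun q _ => hall q).trans ?_
  rw [Finset.sum_const, Finset.card_univ, nsmul_eq_mul]
  exact ENNReal.mul_div_le

end OperatorNorm

end NTK

/-- Networks of depth `L = H + 1`, with Lipschitz nonlinearity `σ` and bias scale `β > 0`, at iid
standard Gaussian initialization. The first part says that the neural tangent kernel is almost
surely well defined; the second and third parts are its convergence in probability to
`Θ_∞^{(L)} ⊗ Id` in the sequential limit, entrywise at all inputs and in the operator norm of every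
finite dataset. -/
theorem theorem1 {n₀ nL : ℕ} {σ : ℝ → ℝ} {c : NNReal} (hσ : LipschitzWith c σ)
    {β : ℝ} (hβ : 0 < β) (H : ℕ) :
    (∀ hs : List ℕ, hs.length = H → ∀ (x : Fin n₀ → ℝ) (k : Fin nL),
      ∀ᵐ θ ∂(NTK.initLaw n₀ hs nL), DifferentiableAt ℝ (fun θ' => NTK.network σ β hs θ' x k) θ) ∧
    (∀ (x x' : Fin n₀ → ℝ) (k k' : Fin nL) (ε : ℝ), 0 < ε →
      Tendsto
        (fun hs : List ℕ => NTK.initLaw n₀ hs nL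
          {θ | ε ≤ |NTK.ntk σ β hs θ x x' k k' -
            NTK.tensorId (NTK.limitNTK σ β H) nL x x' k k'|})
        (NTK.seqAtTop H) (𝓝 0)) ∧
    (∀ (N : ℕ) (X : Fin N → Fin n₀ → ℝ) (ε : ℝ), 0 < ε →
      Tendsto
        (fun hs : List ℕ => NTK.initLaw n₀ hs nL
          {θ | ε ≤ NTK.kernelOpNorm X
            (NTK.ntk σ β hs θ - NTK.tensorId (NTK.limitNTK σ β H) nL)})
        (NTK.seqAtTop H) (𝓝 0)) := by
  refine ⟨fun hs _ x k => ?_, fun x x' k k' ε hε => ?_, fun N X ε hε => ?_⟩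
  · filter_upwards [NTK.ae_differentiableAt_network hσ hβ x hs] with θ hθ using hθ k
  · exact ENNReal.tendsto_nhds_zero.2 fun η hη => NTK.ntk_eventually hσ hβ H x x' k k' hε hη
  · exact ENNReal.tendsto_nhds_zero.2 fun η hη => NTK.kernelOpNorm_eventually hσ hβ H X hε hη
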